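/- Let $(G_k)_{k\in\mathbb N}$ be a sequence of finite connected simple graphs, where $G_k$ has $n_k$ vertices, $n_k\to\infty$, all vertex degrees in all the $G_k$ are at most some constant $D$, and $t_{\mathsf{rel}}(G_k)=\Theta(1)$. Here $t_{\mathsf{rel}}(G)=(1-\tilde\lambda_2)^{-1}$, where $\tilde\lambda_2$ is the second largest eigenvalue of $\tilde{\mathbf P}=(\mathbf I+\mathbf P)/2$ and $\mathbf P$ is the transition matrix of the simple random walk on $G$. For $\varepsilon\in(0,1]$, the $\varepsilon$-time-biased random walk ($\varepsilon$-TBRW) on $G=(V,E)$ under a strategy $(\mathbf B_t)_{t\ge 0}$ is the process $(X_t)_{t\ge0}$ on $V$ with $$\Pr[X_{t+1}=y\mid X_0,\dots,X_t]=\big((1-\varepsilon)\mathbf P+\varepsilon\mathbf B_t\big)_{X_t,y},$$ where each $\mathbf B_t$ is a stochastic matrix, supported on the edges of $G$, chosen by the controller as a function of $t$ and the history $(X_0,\dots,X_t)$. Let $t_{\mathsf{cov}}^{\varepsilon\mathsf{TB}}(G)=\max_{v\in V}\inf \mathbb E_v[\tau_{\mathsf{cov}}]$, where the infimum is over all strategies,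 $\mathbb E_v$ denotes expectation for the walk started from $X_0=v$, and $\tau_{\mathsf{cov}}$ is the first time by which every vertex has been visited. Then $t_{\mathsf{cov}}^{\varepsilon\mathsf{TB}}(G_k)=O\big(\frac{n_k}{\varepsilon}\log\log n_k\big)$ as $k\to\infty$, with an implied constant that does not depend on $\varepsilon$. That is, there is a constant $C$ such that for all sufficiently large $k$ and all $\varepsilon\in(0,1]$, $$t_{\mathsf{cov}}^{\varepsilon\mathsf{TB}}(G_k)\le C\,\frac{n_k}{\varepsilon}\,\log\log n_k .$$ -/

import Mathlib

open Filter Asymptotics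
open scoped Topology

noncomputable section

namespace TBRW

variable {V : Type*} [Fintype V] [DecidableEq V] (G : SimpleGraph V) [DecidableRel G.Adj]

/-- Transition matrix `P` of the (non-lazy) simple random walk on `G`. -/
def srwMatrix : Matrix V V ℝ :=
  Matrix.of fun x y => if G.Adj x y then 1 / (G.degree x : ℝ) else 0

/-- Transition matrix `(I + P) / 2` of the lazy random walk on `G`. -/
def lazyMatrix : Matrix V V ℝ :=
  (1 / 2 : ℝ) • (1 + srwMatrix G)

/-- The second largest eigenvalue of the lazy random walk. On a connected graph the largest
eigenvalue `1` is simple, so this is the largest eigenvalue different from `1`. -/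
def lazySecondEigenvalue : ℝ :=
  sSup {l : ℝ | Module.End.HasEigenvalue (Matrix.toLin' (lazyMatrix G)) l ∧ l ≠ 1}

/-- Relaxation time of the lazy random walk on `G`. -/
def relaxationTime : ℝ :=
  (1 - lazySecondEigenvalue G)⁻¹

/-- A strategy of the controller: for every time `t` and every history `(X_0, …, X_t)`, a bias
matrix `B_t`, i.e. a stochastic matrix whose support is restricted to the edges of `G`. -/
structure Strategy where
  bias : (t : ℕ) → ((i : Finset.Iic t) → V) → Matrix V V ℝ
  stochastic : ∀ t h, bias t h ∈ Matrix.rowStochastic ℝ V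
  supported : ∀ t h x y, bias t h x y ≠ 0 → G.Adj x y

variable {G}

/-- The transition matrix `(1 - ε) P + ε B_t` used for step `t + 1` given the history. -/
def Strategy.stepMatrix (σ : Strategy G) (ε : unitInterval) (t : ℕ)
    (h : (i : Finset.Iic t) → V) : Matrix V V ℝ :=
  (1 - (ε : ℝ)) • srwMatrix G + (ε : ℝ) • σ.bias t h

theorem Strategy.srwMatrix_mem_rowStochastic (σ : Strategy G) :
    srwMatrix G ∈ Matrix.rowStochastic ℝ V := by
  rw [Matrix.mem_rowStochastic_iff_sum]
  refine ⟨fun x y => ?_, fun x => ?_⟩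
  · simp only [srwMatrix, Matrix.of_apply]
    split_ifs <;> positivity
  · have hx : ∃ y, G.Adj x y := by
      by_contra hne
      push Not at hne
      have h1 := Matrix.sum_row_of_mem_rowStochastic (σ.stochastic 0 fun _ => x) x
      have h2 : ∀ y, σ.bias 0 (fun _ => x) x y = 0 := fun y => by
        by_contra hy
        exact hne y (σ.supported _ _ _ _ hy)
      simp [h2] at h1
    have hd : (G.degree x : ℝ) ≠ 0 := by
      exact_mod_cast ((G.degree_pos_iff_exists_adj x).2 hx).ne'
    simp only [srwMatrix, Matrix.of_apply]
    rw [← Finset.sum_filter, Finset.sum_const, ← SimpleGraph.neighborFinset_eq_filter,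
      SimpleGraph.card_neighborFinset_eq_degree]
    simp [hd]

theorem Strategy.stepMatrix_mem_rowStochastic (σ : Strategy G) (ε : unitInterval) (t : ℕ)
    (h : (i : Finset.Iic t) → V) : σ.stepMatrix ε t h ∈ Matrix.rowStochastic ℝ V := by
  have hP := σ.srwMatrix_mem_rowStochastic
  have hB := σ.stochastic t h
  rw [Matrix.mem_rowStochastic_iff_sum] at *
  refine ⟨fun x y => ?_, fun x => ?_⟩
  · have h0 := ε.2.1
    have h1 : 0 ≤ 1 - (ε : ℝ) := sub_nonneg.2 ε.2.2
    have h2 := hP.1 x y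
    have h3 := hB.1 x y
    simp only [stepMatrix, Matrix.add_apply, Matrix.smul_apply, smul_eq_mul]
    positivity
  · simp only [stepMatrix, Matrix.add_apply, Matrix.smul_apply, smul_eq_mul,
      Finset.sum_add_distrib, ← Finset.mul_sum, hP.2 x, hB.2 x]
    ring

variable [MeasurableSpace V] [DiscreteMeasurableSpace V]

/-- Conditional law of `X_{t+1}` given the history `(X_0, …, X_t)`: the row of the step matrix
indexed by the current position `X_t`. -/
def Strategy.stepKernel (σ : Strategy G) (ε : unitInterval) (t : ℕ) :
    ProbabilityTheory.Kernel ((i : Finset.Iic t) → V) V where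
  toFun h := ∑ y, ENNReal.ofReal (σ.stepMatrix ε t h (h ⟨t, Finset.mem_Iic.2 le_rfl⟩) y) •
    MeasureTheory.Measure.dirac y
  measurable' := .of_discrete

instance (σ : Strategy G) (ε : unitInterval) (t : ℕ) :
    ProbabilityTheory.IsMarkovKernel (σ.stepKernel ε t) where
  isProbabilityMeasure h := ⟨by
    have hQ := σ.stepMatrix_mem_rowStochastic ε t h
    rw [Matrix.mem_rowStochastic_iff_sum] at hQ
    simp only [Strategy.stepKernel, ProbabilityTheory.Kernel.coe_mk,
      MeasureTheory.Measure.coe_finsetSum, Finset.sum_apply, MeasureTheory.Measure.smul_apply,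
      MeasureTheory.measure_univ, smul_eq_mul, mul_one]
    rw [← ENNReal.ofReal_sum_of_nonneg fun y _ => hQ.1 _ y, hQ.2, ENNReal.ofReal_one]⟩

/-- Law on `V^ℕ` of the `ε`-time-biased random walk started from `v` under the strategy `σ`
(the measure given by the Ionescu-Tulcea theorem). -/
def Strategy.walkLaw (σ : Strategy G) (ε : unitInterval) (v : V) :
    MeasureTheory.Measure (ℕ → V) :=
  ProbabilityTheory.Kernel.traj (X := fun _ => V) (fun t => σ.stepKernel ε t) 0 fun _ => v

/-- First time by which the trajectory `ω` has visited every vertex (`⊤` if it never does). -/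
def coveringTime (ω : ℕ → V) : ℕ∞ :=
  ⨅ (t : ℕ) (_ : ∀ v, ∃ s ≤ t, ω s = v), (t : ℕ∞)

variable (G) in
/-- Optimal expected covering time of the `ε`-time-biased walk from `v`, over all strategies. -/
def coverTimeFrom (ε : unitInterval) (v : V) : ENNReal :=
  ⨅ σ : Strategy G, ∫⁻ ω, ((coveringTime ω : ℕ∞) : ENNReal) ∂(σ.walkLaw ε v)

variable (G) in
/-- The `ε`-TBRW cover time of `G`. -/
def coverTime (ε : unitInterval) : ENNReal :=
  ⨆ v : V, coverTimeFrom G ε v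

end TBRW

/-- A sequence of graphs is a sequence of expanders if its relaxation times are `Θ(1)`. -/
def TBRW.IsExpanderSequence {N : ℕ → ℕ} (G : (k : ℕ) → SimpleGraph (Fin (N k)))
    [∀ k, DecidableRel (G k).Adj] : Prop :=
  (fun k => TBRW.relaxationTime (G k)) =Θ[atTop] fun _ => (1 : ℝ)

end

/-! Write `n` for the number of vertices and `γ` for a lower bound on the spectral gap of the lazy
walk. Take `T` of order `log n / γ`, beyond the mixing time. In `2 T` steps the simple random walk
mixes and then looks for a set `S`, so when `|S| ≤ n / T` it hits `S` from any start with
probability at least `p |S|`, where `p` is of order `T / n` (`le_hitProb`).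

A controller who always pushes towards the neighbour with the best hitting probability raises a
probability `q` to at least `q ^ (1 - ε)` (`boost_le`, `cost_add_le_of_hit`). With `s ≤ n / T`
vertices left, the next one therefore costs at most `2 T / (p s) ^ (1 - ε)` steps on average.
Summing `s ^ (ε - 1)`, which costs a factor `1 / ε`, bounds this endgame by a multiple of `n / ε`
(`cost_le_of_card_le`).

To reach the endgame the controller imitates the simple random walk. A fixed vertex survives `k`
blocks of `2 T` steps with probability at most `(1 - p) ^ k`, so about `log (2 T) / p` blocks leave
at most half of `n / T + 1` vertices on average. By Markov's inequality the endgame is then reached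
with probability at least `1 / 2`, and otherwise one starts again (`cost_le_of_srw`). This takes
order `n log T`, that is `n log log n`, steps.

The estimates are made on finite-horizon dynamic programming values `cost`, and
`coverTime_le_of_cost_le` transfers them to the law of the walk. -/

noncomputable section

set_option linter.unusedSectionVars false

namespace TBRW

open Matrix

/-! ### Spectral gap of the lazy walk in the degree-weighted inner product. -/

section Spectral

variable {V : Type*} [Fintype V] [DecidableEq V] (G : SimpleGraph V) [DecidableRel G.Adj]

/-- The inner product of functions on `V` weighted by the vertex degrees. -/
def degInner (f g : V → ℝ) : ℝ := ∑ x, (G.degree x : ℝ) * f x * g x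

theorem degInner_comm (f g : V → ℝ) : degInner G f g = degInner G g f := by
  simp only [degInner]
  exact Finset.sum_congr rfl fun x _ => by ring

theorem degInner_add_right (f g h : V → ℝ) :
    degInner G f (g + h) = degInner G f g + degInner G f h := by
  simp only [degInner, ← Finset.sum_add_distrib, Pi.add_apply]
  exact Finset.sum_congr rfl fun x _ => by ring

theorem degInner_smul_right (c : ℝ) (f g : V → ℝ) :
    degInner G f (c • g) = c * degInner G f g := by
  simp only [degInner, Finset.mul_sum, Pi.smul_apply, smul_eq_mul]
  exact Finset.sum_congr rfl fun x _ => by ring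

theorem degInner_add_left (f g h : V → ℝ) :
    degInner G (f + g) h = degInner G f h + degInner G g h := by
  rw [degInner_comm, degInner_add_right, degInner_comm, degInner_comm G h g]

theorem degInner_smul_left (c : ℝ) (f g : V → ℝ) :
    degInner G (c • f) g = c * degInner G f g := by
  rw [degInner_comm, degInner_smul_right, degInner_comm]

theorem degInner_self_nonneg (f : V → ℝ) : 0 ≤ degInner G f f :=
  Finset.sum_nonneg fun x _ => by nlinarith [mul_self_nonneg (f x), (G.degree x).cast_nonneg (α := ℝ)]

theorem degree_mul_srw_mulVec (f : V → ℝ) (x : V) :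
    (G.degree x : ℝ) * (srwMatrix G *ᵥ f) x = (G.adjMatrix ℝ *ᵥ f) x := by
  simp only [mulVec, dotProduct, srwMatrix, of_apply, SimpleGraph.adjMatrix_apply, Finset.mul_sum]
  refine Finset.sum_congr rfl fun y _ => ?_
  split_ifs with h
  · have : (G.degree x : ℝ) ≠ 0 := by
      exact_mod_cast ((G.degree_pos_iff_exists_adj x).2 ⟨y, h⟩).ne'
    field_simp
  · simp

theorem degInner_srw (f g : V → ℝ) :
    degInner G f (srwMatrix G *ᵥ g) = f ⬝ᵥ (G.adjMatrix ℝ *ᵥ g) := by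
  simp only [degInner, dotProduct, ← degree_mul_srw_mulVec]
  exact Finset.sum_congr rfl fun x _ => by ring

theorem degInner_srw_comm (f g : V → ℝ) :
    degInner G f (srwMatrix G *ᵥ g) = degInner G (srwMatrix G *ᵥ f) g := by
  rw [degInner_comm G _ g, degInner_srw, degInner_srw, dotProduct_mulVec, ← mulVec_transpose,
    SimpleGraph.transpose_adjMatrix, dotProduct_comm]

theorem lazy_mulVec (f : V → ℝ) :
    lazyMatrix G *ᵥ f = (1 / 2 : ℝ) • (f + srwMatrix G *ᵥ f) := by
  simp [lazyMatrix, smul_mulVec, add_mulVec]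

variable {G}

theorem srw_nonneg (x y : V) : 0 ≤ srwMatrix G x y := by
  simp only [srwMatrix, of_apply]
  split_ifs <;> positivity

theorem sum_srw (hd : ∀ x, 0 < G.degree x) (x : V) : ∑ y, srwMatrix G x y = 1 := by
  have : (G.degree x : ℝ) ≠ 0 := by exact_mod_cast (hd x).ne'
  simp only [srwMatrix, of_apply]
  rw [← Finset.sum_filter, Finset.sum_const, ← SimpleGraph.neighborFinset_eq_filter,
    SimpleGraph.card_neighborFinset_eq_degree]
  simp [this]

theorem srw_mulVec_mono {f g : V → ℝ} {x : V} (h : ∀ y, G.Adj x y → f y ≤ g y) :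
    (srwMatrix G *ᵥ f) x ≤ (srwMatrix G *ᵥ g) x := by
  refine Finset.sum_le_sum fun y _ => ?_
  by_cases hy : G.Adj x y
  · exact mul_le_mul_of_nonneg_left (h y hy) (srw_nonneg x y)
  · simp [srwMatrix, hy]

theorem srw_mulVec_const (hd : ∀ x, 0 < G.degree x) (c : ℝ) (x : V) :
    (srwMatrix G *ᵥ fun _ => c) x = c := by
  simp only [mulVec, dotProduct, ← Finset.sum_mul, sum_srw hd, one_mul]

theorem srw_mulVec_sq_le (hd : ∀ x, 0 < G.degree x) (f : V → ℝ) (x : V) :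
    (srwMatrix G *ᵥ f) x ^ 2 ≤ (srwMatrix G *ᵥ fun y => f y ^ 2) x := by
  set m := (srwMatrix G *ᵥ f) x with hm
  have h0 : 0 ≤ ∑ y, srwMatrix G x y * (f y - m) ^ 2 :=
    Finset.sum_nonneg fun y _ => mul_nonneg (srw_nonneg x y) (sq_nonneg _)
  have h1 : ∑ y, srwMatrix G x y * (f y - m) ^ 2 =
      (∑ y, srwMatrix G x y * f y ^ 2) - 2 * m * (∑ y, srwMatrix G x y * f y) +
        m ^ 2 * ∑ y, srwMatrix G x y := by
    simp only [Finset.mul_sum, ← Finset.sum_sub_distrib, ← Finset.sum_add_distrib]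
    exact Finset.sum_congr rfl fun y _ => by ring
  have h2 : ∑ y, srwMatrix G x y * f y = m := rfl
  rw [h1, h2, sum_srw hd] at h0
  have h3 : (srwMatrix G *ᵥ fun y => f y ^ 2) x = ∑ y, srwMatrix G x y * f y ^ 2 := rfl
  rw [h3]
  nlinarith

theorem degInner_one_srw (hd : ∀ x, 0 < G.degree x) (f : V → ℝ) :
    degInner G (fun _ => 1) (srwMatrix G *ᵥ f) = degInner G (fun _ => 1) f := by
  rw [degInner_srw_comm]
  congr 1
  exact funext fun x => srw_mulVec_const hd 1 x

theorem degInner_one_lazy (hd : ∀ x, 0 < G.degree x) (f : V → ℝ) :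
    degInner G (fun _ => 1) (lazyMatrix G *ᵥ f) = degInner G (fun _ => 1) f := by
  rw [lazy_mulVec, degInner_smul_right, degInner_add_right, degInner_one_srw hd]
  ring

/-- Jensen's inequality at each vertex, then invariance of the degree measure. -/
theorem degInner_srw_self_le (hd : ∀ x, 0 < G.degree x) (f : V → ℝ) :
    degInner G (srwMatrix G *ᵥ f) (srwMatrix G *ᵥ f) ≤ degInner G f f := by
  have h1 : degInner G (srwMatrix G *ᵥ f) (srwMatrix G *ᵥ f) ≤
      degInner G (fun _ => 1) (srwMatrix G *ᵥ fun y => f y ^ 2) := by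
    refine Finset.sum_le_sum fun x _ => ?_
    have := mul_le_mul_of_nonneg_left (srw_mulVec_sq_le hd f x) (G.degree x).cast_nonneg (α := ℝ)
    nlinarith
  refine h1.trans (le_of_eq ?_)
  rw [degInner_one_srw hd]
  exact Finset.sum_congr rfl fun x _ => by ring

theorem degInner_self_srw_le (hd : ∀ x, 0 < G.degree x) (f : V → ℝ) :
    degInner G f (srwMatrix G *ᵥ f) ≤ degInner G f f := by
  have h := degInner_self_nonneg G (f + (-1 : ℝ) • srwMatrix G *ᵥ f)
  simp only [degInner_add_left, degInner_add_right, degInner_smul_left, degInner_smul_right] at h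
  rw [degInner_comm G (srwMatrix G *ᵥ f) f] at h
  linarith [degInner_srw_self_le hd f]

/-- The lazy operator has its spectrum in `[0, 1]`, so its square is below it. This is what laziness
buys: norms after one step are controlled by the quadratic form, hence by the second largest
eigenvalue alone. -/
theorem degInner_lazy_self_le (hd : ∀ x, 0 < G.degree x) (f : V → ℝ) :
    degInner G (lazyMatrix G *ᵥ f) (lazyMatrix G *ᵥ f) ≤ degInner G f (lazyMatrix G *ᵥ f) := by
  simp only [lazy_mulVec, degInner_add_left, degInner_add_right, degInner_smul_left,
    degInner_smul_right]
  rw [degInner_comm G (srwMatrix G *ᵥ f) f]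
  linarith [degInner_srw_self_le hd f]

theorem degInner_self_lazy_le (hd : ∀ x, 0 < G.degree x) (f : V → ℝ) :
    degInner G f (lazyMatrix G *ᵥ f) ≤ degInner G f f := by
  simp only [lazy_mulVec, degInner_add_right, degInner_smul_right]
  linarith [degInner_self_srw_le hd f]

theorem degInner_self_pos (hd : ∀ x, 0 < G.degree x) {f : V → ℝ} (hf : f ≠ 0) :
    0 < degInner G f f := by
  obtain ⟨x, hx⟩ := Function.ne_iff.1 hf
  refine Finset.sum_pos' (fun y _ => ?_) ⟨x, Finset.mem_univ _, ?_⟩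
  · nlinarith [mul_self_nonneg (f y), (G.degree y).cast_nonneg (α := ℝ)]
  · have h1 : (0 : ℝ) < G.degree x := by exact_mod_cast hd x
    have h2 : 0 < f x * f x := mul_self_pos.2 hx
    nlinarith

theorem lazy_eigenvalue_le_one (hd : ∀ x, 0 < G.degree x) {l : ℝ}
    (hl : Module.End.HasEigenvalue (Matrix.toLin' (lazyMatrix G)) l) : l ≤ 1 := by
  obtain ⟨f, hf⟩ := hl.exists_hasEigenvector
  have h1 : lazyMatrix G *ᵥ f = l • f := by simpa using hf.apply_eq_smul
  have h2 := degInner_self_lazy_le hd f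
  rw [h1, degInner_smul_right] at h2
  exact (mul_le_iff_le_one_left (degInner_self_pos hd hf.2)).1 h2

theorem finite_lazy_eigenvalues :
    {l : ℝ | Module.End.HasEigenvalue (Matrix.toLin' (lazyMatrix G)) l ∧ l ≠ 1}.Finite :=
  (Module.End.finite_hasEigenvalue (Matrix.toLin' (lazyMatrix G))).subset fun _ h => h.1

theorem lazySecondEigenvalue_lt_one (hd : ∀ x, 0 < G.degree x) : lazySecondEigenvalue G < 1 := by
  rcases Set.eq_empty_or_nonempty
    {l : ℝ | Module.End.HasEigenvalue (Matrix.toLin' (lazyMatrix G)) l ∧ l ≠ 1} with h | h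
  -- With no eigenvalue other than `1`, the definition takes the default value `sSup ∅ = 0`.
  · simp [lazySecondEigenvalue, h]
  · have := h.csSup_mem finite_lazy_eigenvalues
    exact lt_of_le_of_ne (lazy_eigenvalue_le_one hd this.1) this.2

theorem le_lazySecondEigenvalue {l : ℝ}
    (hl : Module.End.HasEigenvalue (Matrix.toLin' (lazyMatrix G)) l) (h1 : l ≠ 1) :
    l ≤ lazySecondEigenvalue G :=
  le_csSup finite_lazy_eigenvalues.bddAbove ⟨hl, h1⟩

theorem eq_of_lazy_mulVec_eq_self (hconn : G.Connected) {f : V → ℝ}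
    (hf : lazyMatrix G *ᵥ f = f) (x y : V) : f x = f y := by
  have h1 : srwMatrix G *ᵥ f = f := by
    rw [lazy_mulVec] at hf
    ext x
    have := congrFun hf x
    simp only [Pi.smul_apply, Pi.add_apply, smul_eq_mul] at this
    linarith
  have h2 : G.lapMatrix ℝ *ᵥ f = 0 := by
    rw [SimpleGraph.lapMatrix, sub_mulVec]
    ext x
    rw [Pi.sub_apply, SimpleGraph.degMatrix_mulVec_apply, ← degree_mul_srw_mulVec, h1]
    simp
  exact (SimpleGraph.lapMatrix_mulVec_eq_zero_iff_forall_reachable G).1 h2 x y (hconn x y)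

variable (G) in
/-- The symmetric matrix similar to the lazy transition matrix. -/
def symmLazyMatrix : Matrix V V ℝ :=
  Matrix.of fun x y => √(G.degree x) * lazyMatrix G x y * (√(G.degree y))⁻¹

theorem symmLazyMatrix_isHermitian (hd : ∀ x, 0 < G.degree x) :
    (symmLazyMatrix G).IsHermitian := by
  ext x y
  have hx : 0 < √(G.degree x : ℝ) := Real.sqrt_pos.2 (by exact_mod_cast hd x)
  have hy : 0 < √(G.degree y : ℝ) := Real.sqrt_pos.2 (by exact_mod_cast hd y)
  have hx2 := Real.sq_sqrt (Nat.cast_nonneg (α := ℝ) (G.degree x))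
  have hy2 := Real.sq_sqrt (Nat.cast_nonneg (α := ℝ) (G.degree y))
  simp only [symmLazyMatrix, conjTranspose_apply, of_apply, star_trivial, lazyMatrix,
    Matrix.smul_apply, Matrix.add_apply, srwMatrix, smul_eq_mul]
  by_cases hxy : x = y
  · subst hxy; rfl
  · rw [one_apply_ne hxy, one_apply_ne (Ne.symm hxy)]
    by_cases h : G.Adj x y
    · simp only [h, h.symm, if_true]
      rw [← hx2, ← hy2]
      simp only [Real.sqrt_sq hx.le, Real.sqrt_sq hy.le]
      field_simp
      ring
    · have h' : ¬ G.Adj y x := fun h' => h h'.symm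
      simp [h, h']

theorem symmLazyMatrix_mulVec (hd : ∀ x, 0 < G.degree x) (f : V → ℝ) (x : V) :
    (symmLazyMatrix G *ᵥ fun y => √(G.degree y) * f y) x =
      √(G.degree x) * (lazyMatrix G *ᵥ f) x := by
  simp only [mulVec, dotProduct, symmLazyMatrix, of_apply, Finset.mul_sum]
  refine Finset.sum_congr rfl fun y _ => ?_
  have hy : 0 < √(G.degree y : ℝ) := Real.sqrt_pos.2 (by exact_mod_cast hd y)
  field_simp

theorem degInner_eq_dotProduct (f g : V → ℝ) :
    degInner G f g = (fun y => √(G.degree y) * f y) ⬝ᵥ fun y => √(G.degree y) * g y := by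
  refine Finset.sum_congr rfl fun x _ => ?_
  have hx2 := Real.mul_self_sqrt (Nat.cast_nonneg (α := ℝ) (G.degree x))
  calc _ = (√(G.degree x : ℝ) * √(G.degree x)) * f x * g x := by rw [hx2]
    _ = _ := by ring

/-- The Poincaré inequality for the lazy random walk on a connected graph. -/
theorem degInner_lazy_le_of_mean_zero (hconn : G.Connected) (hd : ∀ x, 0 < G.degree x)
    {f : V → ℝ} (hf : degInner G (fun _ => 1) f = 0) :
    degInner G f (lazyMatrix G *ᵥ f) ≤ lazySecondEigenvalue G * degInner G f f := by
  set hA := symmLazyMatrix_isHermitian (G := G) hd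
  set b := hA.eigenvectorBasis
  set g : V → ℝ := fun y => √(G.degree y) * f y with hg
  set w : EuclideanSpace ℝ V := WithLp.toLp 2 g with hw
  have hAg : symmLazyMatrix G *ᵥ g = fun x => √(G.degree x) * (lazyMatrix G *ᵥ f) x :=
    funext fun x => symmLazyMatrix_mulVec hd f x
  have hinner : ∀ u v : EuclideanSpace ℝ V, inner ℝ u v = (u : V → ℝ) ⬝ᵥ (v : V → ℝ) := by
    intro u v
    rw [EuclideanSpace.inner_eq_star_dotProduct, star_trivial, dotProduct_comm]
  have hAb : ∀ i, inner ℝ (b i) (WithLp.toLp 2 (symmLazyMatrix G *ᵥ g)) =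
      hA.eigenvalues i * inner ℝ (b i) w := by
    intro i
    rw [hinner, hinner, dotProduct_mulVec, ← mulVec_transpose]
    have : (symmLazyMatrix G)ᵀ = symmLazyMatrix G := by simpa using hA.eq
    rw [this, hA.mulVec_eigenvectorBasis, smul_dotProduct, smul_eq_mul]
  have e1 : degInner G f (lazyMatrix G *ᵥ f) =
      ∑ i, hA.eigenvalues i * inner ℝ (b i) w ^ 2 := by
    rw [degInner_eq_dotProduct, ← hAg]
    have := b.sum_inner_mul_inner w (WithLp.toLp 2 (symmLazyMatrix G *ᵥ g))
    rw [hinner] at this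
    refine this.symm.trans (Finset.sum_congr rfl fun i _ => ?_)
    rw [hAb, real_inner_comm]
    ring
  have e2 : degInner G f f = ∑ i, inner ℝ (b i) w ^ 2 := by
    rw [degInner_eq_dotProduct]
    have := b.sum_inner_mul_inner w w
    rw [hinner] at this
    refine this.symm.trans (Finset.sum_congr rfl fun i _ => ?_)
    rw [real_inner_comm]
    ring
  rw [e1, e2, Finset.mul_sum]
  refine Finset.sum_le_sum fun i _ => ?_
  set φ : V → ℝ := fun y => (√(G.degree y))⁻¹ * b i y with hφ
  have hbφ : (b i : V → ℝ) = fun y => √(G.degree y) * φ y := by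
    ext y
    have hy : 0 < √(G.degree y : ℝ) := Real.sqrt_pos.2 (by exact_mod_cast hd y)
    simp only [hφ]
    field_simp
  have hφe : lazyMatrix G *ᵥ φ = hA.eigenvalues i • φ := by
    ext x
    have hx : 0 < √(G.degree x : ℝ) := Real.sqrt_pos.2 (by exact_mod_cast hd x)
    have h1 := congrFun (hA.mulVec_eigenvectorBasis i) x
    change (symmLazyMatrix G *ᵥ (b i : V → ℝ)) x = (hA.eigenvalues i • (b i : V → ℝ)) x at h1
    rw [hbφ, symmLazyMatrix_mulVec hd] at h1
    simp only [Pi.smul_apply, smul_eq_mul] at h1 ⊢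
    exact mul_left_cancel₀ hx.ne' (by rw [h1]; ring)
  have hφ0 : φ ≠ 0 := by
    intro h
    have h1 : (b i : V → ℝ) = 0 := by rw [hbφ, h]; ext; simp
    have h2 : inner ℝ (b i) (b i) = (1 : ℝ) := by
      rw [real_inner_self_eq_norm_sq, b.orthonormal.1 i]; norm_num
    rw [hinner, h1] at h2
    simp at h2
  -- After undoing the conjugation by `√(deg)`, an eigenvector for `1` is constant by connectedness,
  -- hence orthogonal to `f`. All other eigenvalues are at most the second one.
  by_cases h1 : hA.eigenvalues i = 1
  · have hc := eq_of_lazy_mulVec_eq_self hconn (f := φ) (by rw [hφe, h1, one_smul])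
    have : inner ℝ (b i) w = (0 : ℝ) := by
      obtain ⟨x0⟩ := hconn.nonempty
      rw [hinner, hbφ]
      change (fun y => √(G.degree y) * φ y) ⬝ᵥ (fun y => √(G.degree y) * f y) = 0
      rw [← degInner_eq_dotProduct]
      have : φ = φ x0 • (fun _ : V => (1 : ℝ)) := by
        ext x; simp [hc x x0]
      rw [this, degInner_smul_left, hf, mul_zero]
    rw [this]
    simp
  · refine mul_le_mul_of_nonneg_right (le_lazySecondEigenvalue ?_ h1) (sq_nonneg _)
    refine Module.End.hasEigenvalue_of_hasEigenvector (x := φ) ?_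
    rw [Module.End.hasEigenvector_iff, Module.End.mem_eigenspace_iff]
    exact ⟨by simpa using hφe, hφ0⟩

end Spectral

/-! ### Decay of the probability that the lazy walk misses a set. -/

section Hitting

variable {V : Type*} [Fintype V] [DecidableEq V] {G : SimpleGraph V} [DecidableRel G.Adj]

/-- Cauchy–Schwarz on the complement of `S`, whose degree measure is the first factor. -/
theorem degInner_one_sq_le {f : V → ℝ} {S : Finset V} (hf : ∀ x ∈ S, f x = 0) :
    degInner G (fun _ => 1) f ^ 2 ≤
      (degInner G (fun _ => 1) (fun _ => 1) - ∑ x ∈ S, (G.degree x : ℝ)) * degInner G f f := by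
  have h1 : degInner G (fun _ => 1) f =
      ∑ x ∈ Sᶜ, √(G.degree x) * (√(G.degree x) * f x) := by
    have : degInner G (fun _ => 1) f = ∑ x, √(G.degree x : ℝ) * (√(G.degree x) * f x) :=
      Finset.sum_congr rfl fun x _ => by
        rw [← mul_assoc, Real.mul_self_sqrt (Nat.cast_nonneg _), mul_one]
    rw [this, ← Finset.sum_compl_add_sum S, add_eq_left]
    exact Finset.sum_eq_zero fun x hx => by rw [hf x hx]; ring
  have h2 : ∑ x ∈ Sᶜ, √(G.degree x : ℝ) ^ 2 =
      degInner G (fun _ => 1) (fun _ => 1) - ∑ x ∈ S, (G.degree x : ℝ) := by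
    rw [eq_sub_iff_add_eq]
    simp only [degInner, Real.sq_sqrt (Nat.cast_nonneg _), mul_one]
    exact Finset.sum_compl_add_sum S _
  have h3 : ∑ x ∈ Sᶜ, (√(G.degree x : ℝ) * f x) ^ 2 ≤ degInner G f f := by
    refine (Finset.sum_le_sum_of_subset_of_nonneg (Finset.subset_univ _)
      fun x _ _ => sq_nonneg _).trans (le_of_eq (Finset.sum_congr rfl fun x _ => ?_))
    rw [mul_pow, Real.sq_sqrt (Nat.cast_nonneg _)]
    ring
  rw [h1, ← h2]
  refine (Finset.sum_mul_sq_le_sq_mul_sq _ _ _).trans ?_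
  exact mul_le_mul_of_nonneg_left h3 (Finset.sum_nonneg fun x _ => sq_nonneg _)

theorem degInner_one_one_pos [Nonempty V] (hd : ∀ x, 0 < G.degree x) :
    0 < degInner G (fun _ => 1) (fun _ => 1) := by
  refine degInner_self_pos hd fun h => ?_
  obtain ⟨x⟩ := ‹Nonempty V›
  simpa using congrFun h x

theorem card_le_sum_degree (hd : ∀ x, 0 < G.degree x) (S : Finset V) :
    (S.card : ℝ) ≤ ∑ x ∈ S, (G.degree x : ℝ) := by
  rw [Finset.cast_card]
  exact Finset.sum_le_sum fun x _ => by exact_mod_cast hd x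

theorem card_div_le_one [Nonempty V] (hd : ∀ x, 0 < G.degree x) (S : Finset V) :
    (S.card : ℝ) / degInner G (fun _ => 1) (fun _ => 1) ≤ 1 := by
  rw [div_le_one (degInner_one_one_pos hd)]
  refine (card_le_sum_degree hd S).trans ?_
  simp only [degInner, mul_one]
  exact Finset.sum_le_sum_of_subset_of_nonneg (Finset.subset_univ _) fun x _ _ => by positivity

theorem degInner_one_one_le {D : ℕ} (hD : ∀ x, G.degree x ≤ D) :
    degInner G (fun _ => 1) (fun _ => 1) ≤ D * Fintype.card V := by
  have : degInner G (fun _ => 1) (fun _ => 1) ≤ ∑ _x : V, (D : ℝ) :=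
    Finset.sum_le_sum fun x _ => by simpa using hD x
  simpa [mul_comm] using this

theorem lazy_mulVec_const (hd : ∀ x, 0 < G.degree x) (c : ℝ) :
    (lazyMatrix G *ᵥ fun _ => c) = fun _ => c := by
  ext x
  simp only [lazy_mulVec, Pi.smul_apply, Pi.add_apply, srw_mulVec_const hd, smul_eq_mul]
  ring

/-- Quadratic form of the lazy walk in terms of the mean. -/
theorem degInner_lazy_le (hconn : G.Connected) (hd : ∀ x, 0 < G.degree x) {γ : ℝ}
    (hγ : lazySecondEigenvalue G ≤ 1 - γ) (f : V → ℝ) :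
    degInner G f (lazyMatrix G *ᵥ f) ≤ (1 - γ) * degInner G f f +
      γ * (degInner G (fun _ => 1) f ^ 2 / degInner G (fun _ => 1) (fun _ => 1)) := by
  have := hconn.nonempty
  have hZ := degInner_one_one_pos hd
  set Z := degInner G (fun _ => 1) (fun _ => 1)
  set m := degInner G (fun _ => 1) f with hm
  set o : V → ℝ := fun _ => 1 with ho
  have hLo : lazyMatrix G *ᵥ o = o := lazy_mulVec_const hd 1
  -- Subtracting the mean of `f` makes the Poincaré inequality applicable.
  have hg0 : degInner G o (f + (-(m / Z)) • o) = 0 := by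
    rw [degInner_add_right, degInner_smul_right, ← hm]
    field_simp
    ring
  have h1 := degInner_lazy_le_of_mean_zero hconn hd hg0
  have h2 := mul_le_mul_of_nonneg_right hγ (degInner_self_nonneg G (f + (-(m / Z)) • o))
  have h3 := h1.trans h2
  rw [mulVec_add, mulVec_smul, hLo] at h3
  simp only [degInner_add_left, degInner_add_right, degInner_smul_left, degInner_smul_right] at h3
  rw [degInner_one_lazy hd, degInner_comm G f o, ← hm] at h3
  have hoo : degInner G o o = Z := rfl
  rw [hoo] at h3
  have e : m / Z * (m / Z * Z) = m ^ 2 / Z := by field_simp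
  have e' : m / Z * m = m ^ 2 / Z := by ring
  have h4 : degInner G f (lazyMatrix G *ᵥ f) - m ^ 2 / Z ≤
      (1 - γ) * (degInner G f f - m ^ 2 / Z) := by
    have : -(m / Z) * (-(m / Z) * Z) = m ^ 2 / Z := by rw [← e]; ring
    rw [mul_add, this] at h3
    have e'' : -(m / Z) * m = - (m ^ 2 / Z) := by rw [← e']; ring
    rw [e''] at h3
    linarith
  linarith

variable (G) in
/-- Probability that the lazy walk avoids `S` at all times `0, …, n`. -/
def lazyMiss (S : Finset V) : ℕ → V → ℝ
  | 0, x => if x ∈ S then 0 else 1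
  | n + 1, x => if x ∈ S then 0 else (lazyMatrix G *ᵥ lazyMiss S n) x

theorem lazyMiss_of_mem {S : Finset V} {x : V} (hx : x ∈ S) (n : ℕ) : lazyMiss G S n x = 0 := by
  cases n <;> simp [lazyMiss, hx]

/-- A function vanishing on `S` has a mean too small, by Cauchy–Schwarz, to carry its whole norm, so
the gap removes a proportion `γ |S| / Z` of the squared norm at each step. -/
theorem degInner_lazyMiss_le (hconn : G.Connected) (hd : ∀ x, 0 < G.degree x) {γ : ℝ}
    (hγ0 : 0 ≤ γ) (hγ1 : γ ≤ 1) (hγ : lazySecondEigenvalue G ≤ 1 - γ) (S : Finset V) (n : ℕ) :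
    degInner G (lazyMiss G S n) (lazyMiss G S n) ≤
      (1 - γ * (S.card / degInner G (fun _ => 1) (fun _ => 1))) ^ n *
        degInner G (fun _ => 1) (fun _ => 1) := by
  have := hconn.nonempty
  have hZ := degInner_one_one_pos hd
  set Z := degInner G (fun _ => 1) (fun _ => 1) with hZdef
  have hSZ : (S.card : ℝ) / Z ≤ 1 := card_div_le_one hd S
  have hρ : 0 ≤ 1 - γ * (S.card / Z) := by
    have : 0 ≤ (S.card : ℝ) / Z := by positivity
    nlinarith
  induction n with
  | zero =>
    rw [pow_zero, one_mul]
    refine Finset.sum_le_sum fun x _ => ?_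
    by_cases hx : x ∈ S <;> simp [lazyMiss, hx]
  | succ n ih =>
    have h1 : degInner G (lazyMiss G S (n + 1)) (lazyMiss G S (n + 1)) ≤
        degInner G (lazyMatrix G *ᵥ lazyMiss G S n) (lazyMatrix G *ᵥ lazyMiss G S n) := by
      refine Finset.sum_le_sum fun x _ => ?_
      by_cases hx : x ∈ S
      · simp only [lazyMiss, hx, if_true]
        rw [mul_zero, mul_assoc]
        exact mul_nonneg (Nat.cast_nonneg _) (mul_self_nonneg _)
      · simp [lazyMiss, hx]
    have h2 := degInner_lazy_self_le hd (lazyMiss G S n)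
    have h3 := degInner_lazy_le hconn hd hγ (lazyMiss G S n)
    have h4 := degInner_one_sq_le (G := G) (f := lazyMiss G S n) (S := S)
      fun x hx => lazyMiss_of_mem hx n
    have h5 := degInner_self_nonneg G (lazyMiss G S n)
    have h6 : degInner G (fun _ => 1) (lazyMiss G S n) ^ 2 ≤
        (Z - S.card) * degInner G (lazyMiss G S n) (lazyMiss G S n) :=
      h4.trans (mul_le_mul_of_nonneg_right (sub_le_sub_left (card_le_sum_degree hd S) _) h5)
    have h7 : degInner G (fun _ => 1) (lazyMiss G S n) ^ 2 / Z ≤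
        (1 - S.card / Z) * degInner G (lazyMiss G S n) (lazyMiss G S n) := by
      rw [div_le_iff₀ hZ]
      refine h6.trans (le_of_eq ?_)
      field_simp
    calc _ ≤ _ := h1.trans (h2.trans h3)
      _ ≤ (1 - γ) * degInner G (lazyMiss G S n) (lazyMiss G S n) +
          γ * ((1 - S.card / Z) * degInner G (lazyMiss G S n) (lazyMiss G S n)) := by gcongr
      _ = (1 - γ * (S.card / Z)) * degInner G (lazyMiss G S n) (lazyMiss G S n) := by ring
      _ ≤ (1 - γ * (S.card / Z)) * ((1 - γ * (S.card / Z)) ^ n * Z) := by gcongr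
      _ = _ := by ring

/-- Mean probability of missing `S`, for the stationary lazy walk. -/
theorem mean_lazyMiss_le (hconn : G.Connected) (hd : ∀ x, 0 < G.degree x) {γ : ℝ}
    (hγ0 : 0 ≤ γ) (hγ1 : γ ≤ 1) (hγ : lazySecondEigenvalue G ≤ 1 - γ) (S : Finset V) (n : ℕ) :
    degInner G (fun _ => 1) (lazyMiss G S n) / degInner G (fun _ => 1) (fun _ => 1) ≤
      Real.exp (-(γ * S.card * n / (2 * degInner G (fun _ => 1) (fun _ => 1)))) := by
  have := hconn.nonempty
  have hZ := degInner_one_one_pos hd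
  have h1 := degInner_lazyMiss_le hconn hd hγ0 hγ1 hγ S n
  -- Passing from the squared norm to the mean takes a square root, whence the `2` in the exponent.
  have h2 := degInner_one_sq_le (G := G) (f := lazyMiss G S n) (S := ∅) (by simp)
  rw [Finset.sum_empty, sub_zero] at h2
  set Z := degInner G (fun _ => 1) (fun _ => 1) with hZdef
  have h3 : (1 - γ * (S.card / Z)) ^ n ≤ Real.exp (-(γ * S.card * n / (2 * Z))) ^ 2 := by
    have e : Real.exp (-(γ * S.card * n / (2 * Z))) ^ 2 = Real.exp (-(γ * (S.card / Z))) ^ n := by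
      rw [← Real.exp_nat_mul, ← Real.exp_nat_mul]
      congr 1
      push_cast
      field_simp
    rw [e]
    refine pow_le_pow_left₀ ?_ ?_ n
    · have hSZ : (S.card : ℝ) / Z ≤ 1 := card_div_le_one hd S
      have : 0 ≤ (S.card : ℝ) / Z := by positivity
      nlinarith
    · have := Real.add_one_le_exp (-(γ * (S.card / Z)))
      linarith
  rw [div_le_iff₀ hZ]
  refine abs_le_of_sq_le_sq' ?_ (by positivity) |>.2
  calc _ ≤ Z * ((1 - γ * (S.card / Z)) ^ n * Z) :=
        h2.trans (mul_le_mul_of_nonneg_left h1 hZ.le)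
    _ = (1 - γ * (S.card / Z)) ^ n * Z ^ 2 := by ring
    _ ≤ Real.exp (-(γ * S.card * n / (2 * Z))) ^ 2 * Z ^ 2 := by gcongr
    _ = _ := by ring

theorem degInner_lazy_pow_le (hconn : G.Connected) (hd : ∀ x, 0 < G.degree x) {γ : ℝ}
    (hγ1 : γ ≤ 1) (hγ : lazySecondEigenvalue G ≤ 1 - γ) {f : V → ℝ}
    (hf : degInner G (fun _ => 1) f = 0) (n : ℕ) :
    degInner G (fun _ => 1) (lazyMatrix G ^ n *ᵥ f) = 0 ∧
    degInner G (lazyMatrix G ^ n *ᵥ f) (lazyMatrix G ^ n *ᵥ f) ≤ (1 - γ) ^ n * degInner G f f := by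
  induction n with
  | zero => simp [hf]
  | succ n ih =>
    rw [pow_succ', ← mulVec_mulVec]
    refine ⟨by rw [degInner_one_lazy hd, ih.1], ?_⟩
    refine (degInner_lazy_self_le hd _).trans ((degInner_lazy_le hconn hd hγ _).trans ?_)
    rw [ih.1]
    have := mul_le_mul_of_nonneg_left ih.2 (sub_nonneg.2 hγ1)
    rw [pow_succ (1 - γ), zero_pow two_ne_zero, zero_div]
    linarith

theorem lazy_pow_mulVec_const (hd : ∀ x, 0 < G.degree x) (c : ℝ) (n : ℕ) :
    (lazyMatrix G ^ n *ᵥ fun _ => c) = fun _ => c := by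
  induction n with
  | zero => simp
  | succ n ih => rw [pow_succ, ← mulVec_mulVec, lazy_mulVec_const hd, ih]

/-- The first `n` steps mix, which replaces the starting point by the stationary law up to `δ`; the
next `n` steps look for `S`. Degrees are at least `1`, so the weighted norm dominates pointwise
values. -/
theorem lazy_pow_lazyMiss_le (hconn : G.Connected) (hd : ∀ x, 0 < G.degree x) {γ : ℝ}
    (hγ0 : 0 ≤ γ) (hγ1 : γ ≤ 1) (hγ : lazySecondEigenvalue G ≤ 1 - γ) (S : Finset V) (n : ℕ) (x : V)
    {δ : ℝ} (hδ : 0 ≤ δ) (hδn : (1 - γ) ^ n * degInner G (fun _ => 1) (fun _ => 1) ≤ δ ^ 2) :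
    (lazyMatrix G ^ n *ᵥ lazyMiss G S n) x ≤
      Real.exp (-(γ * S.card * n / (2 * degInner G (fun _ => 1) (fun _ => 1)))) + δ := by
  have := hconn.nonempty
  have hZ := degInner_one_one_pos hd
  have h1 := mean_lazyMiss_le hconn hd hγ0 hγ1 hγ S n
  set Z := degInner G (fun _ => 1) (fun _ => 1) with hZdef
  set u := lazyMiss G S n with hu
  set m := degInner G (fun _ => 1) u / Z with hm
  set o : V → ℝ := fun _ => 1 with ho
  have hmZ : degInner G o u = m * Z := by rw [hm]; field_simp
  have hg0 : degInner G o (u + (-m) • o) = 0 := by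
    rw [degInner_add_right, degInner_smul_right, hmZ]
    change m * Z + -m * Z = 0
    ring
  have hgg : degInner G (u + (-m) • o) (u + (-m) • o) ≤ Z := by
    have e : degInner G (u + (-m) • o) (u + (-m) • o) = degInner G u u - m ^ 2 * Z := by
      simp only [degInner_add_left, degInner_add_right, degInner_smul_left, degInner_smul_right]
      rw [degInner_comm G u o, hmZ]
      rw [← hZdef]
      ring
    have h2 := degInner_lazyMiss_le hconn hd hγ0 hγ1 hγ S n
    have h3 : degInner G u u ≤ Z := by
      refine h2.trans ?_
      have hSZ : (S.card : ℝ) / Z ≤ 1 := card_div_le_one hd S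
      have : 0 ≤ (S.card : ℝ) / Z := div_nonneg (Nat.cast_nonneg _) hZ.le
      have h4 : (1 - γ * (S.card / Z)) ^ n ≤ 1 := pow_le_one₀ (by nlinarith) (by nlinarith)
      nlinarith
    rw [e]
    nlinarith [mul_nonneg (sq_nonneg m) hZ.le]
  have h2 := (degInner_lazy_pow_le hconn hd hγ1 hγ hg0 n).2
  have e : lazyMatrix G ^ n *ᵥ (u + (-m) • o) = fun y => (lazyMatrix G ^ n *ᵥ u) y - m := by
    rw [mulVec_add, mulVec_smul, lazy_pow_mulVec_const hd]
    ext y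
    change (lazyMatrix G ^ n *ᵥ u) y + -m * 1 = _
    ring
  rw [e] at h2
  have h3 : ((lazyMatrix G ^ n *ᵥ u) x - m) ^ 2 ≤ δ ^ 2 := by
    refine le_trans ?_ (h2.trans ((mul_le_mul_of_nonneg_left hgg
      (pow_nonneg (sub_nonneg.2 hγ1) n)).trans hδn))
    refine le_trans ?_ (Finset.single_le_sum (f := fun y => (G.degree y : ℝ) *
      ((lazyMatrix G ^ n *ᵥ u) y - m) * ((lazyMatrix G ^ n *ᵥ u) y - m)) (fun y _ => ?_)
      (Finset.mem_univ x))
    · have : (1 : ℝ) ≤ G.degree x := by exact_mod_cast hd x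
      nlinarith [sq_nonneg ((lazyMatrix G ^ n *ᵥ u) x - m)]
    · rw [mul_assoc]
      exact mul_nonneg (Nat.cast_nonneg _) (mul_self_nonneg _)
  have h4 := (abs_le_of_sq_le_sq' h3 hδ).2
  linarith

/-! ### Hitting probabilities of the simple random walk, compared with the lazy walk. -/

variable (G) in
/-- Probability that the simple random walk visits `S` by time `n`. -/
def hitProb (S : Finset V) : ℕ → V → ℝ
  | 0, x => if x ∈ S then 1 else 0
  | n + 1, x => if x ∈ S then 1 else (srwMatrix G *ᵥ hitProb S n) x

theorem hitProb_of_mem {S : Finset V} {x : V} (hx : x ∈ S) (n : ℕ) : hitProb G S n x = 1 := by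
  cases n <;> simp [hitProb, hx]

theorem hitProb_nonneg (S : Finset V) (n : ℕ) (x : V) : 0 ≤ hitProb G S n x := by
  induction n generalizing x with
  | zero => simp only [hitProb]; split_ifs <;> norm_num
  | succ n ih =>
    simp only [hitProb]
    split_ifs
    · norm_num
    · exact Finset.sum_nonneg fun y _ => mul_nonneg (srw_nonneg x y) (ih y)

theorem hitProb_le_one (hd : ∀ x, 0 < G.degree x) (S : Finset V) (n : ℕ) (x : V) :
    hitProb G S n x ≤ 1 := by
  induction n generalizing x with
  | zero => simp only [hitProb]; split_ifs <;> norm_num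
  | succ n ih =>
    simp only [hitProb]
    split_ifs
    · norm_num
    · exact (srw_mulVec_mono fun y _ => ih y).trans_eq (srw_mulVec_const hd 1 x)

theorem srw_hitProb_le (hd : ∀ x, 0 < G.degree x) (S : Finset V) (n : ℕ) (x : V) :
    (srwMatrix G *ᵥ hitProb G S n) x ≤ hitProb G S (n + 1) x := by
  simp only [hitProb]
  split_ifs
  · exact (srw_mulVec_mono fun y _ => hitProb_le_one hd S n y).trans_eq (srw_mulVec_const hd 1 x)
  · exact le_rfl

theorem hitProb_le_succ (S : Finset V) (n : ℕ) (x : V) :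
    hitProb G S n x ≤ hitProb G S (n + 1) x := by
  induction n generalizing x with
  | zero =>
    by_cases hx : x ∈ S
    · simp [hitProb, hx]
    · rw [hitProb, if_neg hx]
      exact hitProb_nonneg S _ x
  | succ n ih =>
    by_cases hx : x ∈ S
    · simp [hitProb, hx]
    · rw [hitProb, hitProb, if_neg hx, if_neg hx]
      exact srw_mulVec_mono fun y _ => ih y

/-- Holding only delays the walk: hitting probabilities increase with time, so a step wasted in
place cannot help. Estimates for the lazy walk thus pass to the simple one. -/
theorem one_sub_hitProb_le_lazy (hd : ∀ x, 0 < G.degree x) (S : Finset V) (n : ℕ) {f : V → ℝ}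
    (hf : ∀ x, 1 - hitProb G S n x ≤ f x) (x : V) :
    1 - hitProb G S (n + 1) x ≤ (lazyMatrix G *ᵥ f) x := by
  have h1 := srw_mulVec_mono (G := G) (f := fun y => 1 - f y) (g := hitProb G S n) (x := x)
    fun y _ => by linarith [hf y]
  have h2 : (srwMatrix G *ᵥ fun y => 1 - f y) x = 1 - (srwMatrix G *ᵥ f) x := by
    have : (fun y => 1 - f y) = (fun _ => (1 : ℝ)) - f := rfl
    rw [this, mulVec_sub, Pi.sub_apply, srw_mulVec_const hd]
  have h3 := srw_hitProb_le hd S n x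
  have h4 := hitProb_le_succ (G := G) S n x
  have h5 := hf x
  rw [lazy_mulVec]
  simp only [Pi.smul_apply, Pi.add_apply, smul_eq_mul]
  linarith

theorem one_sub_hitProb_le_lazyMiss (hd : ∀ x, 0 < G.degree x) (S : Finset V) (n : ℕ) (x : V) :
    1 - hitProb G S n x ≤ lazyMiss G S n x := by
  induction n generalizing x with
  | zero => by_cases hx : x ∈ S <;> simp [lazyMiss, hitProb, hx]
  | succ n ih =>
    by_cases hx : x ∈ S
    · simp [lazyMiss, hitProb, hx]
    · have := one_sub_hitProb_le_lazy hd S n ih x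
      simpa [lazyMiss, hx] using this

theorem one_sub_hitProb_le_lazy_pow (hd : ∀ x, 0 < G.degree x) (S : Finset V) (n i : ℕ) (x : V) :
    1 - hitProb G S (n + i) x ≤ (lazyMatrix G ^ i *ᵥ lazyMiss G S n) x := by
  induction i generalizing x with
  | zero => simpa using one_sub_hitProb_le_lazyMiss hd S n x
  | succ i ih =>
    rw [pow_succ', ← mulVec_mulVec]
    exact one_sub_hitProb_le_lazy hd S (n + i) ih x

/-- On an expander, a small set `S` is hit within `2 T` steps with probability of order
`|S| T / n`, from any starting vertex, as soon as `T` exceeds the mixing time. -/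
theorem le_hitProb (hconn : G.Connected) (hd : ∀ x, 0 < G.degree x) {γ : ℝ}
    (hγ0 : 0 < γ) (hγ1 : γ ≤ 1) (hγ : lazySecondEigenvalue G ≤ 1 - γ)
    {D : ℕ} (hD : ∀ x, G.degree x ≤ D) {T : ℕ} (hT : 0 < T)
    (hmix : (1 - γ) ^ T * (D * Fintype.card V) ≤ (γ / (8 * (D * Fintype.card V))) ^ 2)
    {S : Finset V} (hS : S.Nonempty) (hST : S.card * T ≤ Fintype.card V) (x : V) :
    γ / (8 * D) * (S.card * T / Fintype.card V) ≤ hitProb G S (2 * T) x := by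
  have := hconn.nonempty
  have hZ := degInner_one_one_pos hd
  have hZD := degInner_one_one_le hD
  have hD0 : (1 : ℝ) ≤ D := by
    obtain ⟨x⟩ := this
    exact_mod_cast (hd x).trans_le (hD x)
  have hn : (0 : ℝ) < Fintype.card V := by exact_mod_cast Fintype.card_pos
  set n : ℝ := (Fintype.card V : ℝ)
  -- This `δ` is at most `a / 4` for the `a` below, because `|S| T ≥ 1`. Together with `exp (-a) ≤ 1
  -- - a / 2`, a hitting probability of `a / 4` remains.
  have h1 := lazy_pow_lazyMiss_le hconn hd hγ0.le hγ1 hγ S T x (δ := γ / (8 * (D * n)))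
    (by positivity)
    ((mul_le_mul_of_nonneg_left hZD (pow_nonneg (sub_nonneg.2 hγ1) T)).trans hmix)
  have h2 := one_sub_hitProb_le_lazy_pow hd S T T x
  rw [← two_mul] at h2
  have hST1 : (1 : ℝ) ≤ S.card * T := by
    exact_mod_cast Nat.mul_pos hS.card_pos hT
  have hSTn : (S.card * T : ℝ) ≤ n := by
    rw [← Nat.cast_mul]
    exact Nat.cast_le.2 hST
  set a : ℝ := γ * S.card * T / (2 * (D * n)) with ha
  have ha0 : 0 ≤ a := by positivity
  have ha1 : a ≤ 1 := by
    rw [ha, div_le_one (by positivity)]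
    have : γ * (S.card * T) ≤ 1 * n := by gcongr
    nlinarith
  have h3 : Real.exp (-(γ * S.card * T / (2 * degInner G (fun _ => 1) (fun _ => 1)))) ≤
      Real.exp (-a) := by
    rw [Real.exp_le_exp, neg_le_neg_iff, ha]
    gcongr
  have h4 : Real.exp (-a) ≤ 1 - a / 2 := by
    rw [Real.exp_neg, inv_le_comm₀ (Real.exp_pos _) (by linarith)]
    refine le_trans ?_ (Real.add_one_le_exp a)
    rw [inv_le_iff_one_le_mul₀ (by linarith)]
    nlinarith
  have h5 : γ / (8 * (D * n)) ≤ a / 4 := by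
    have : a / 4 = γ / (8 * (D * n)) * (S.card * T) := by
      rw [ha]; field_simp; ring
    rw [this]
    exact le_mul_of_one_le_right (by positivity) hST1
  have h6 : γ / (8 * D) * (S.card * T / n) = a / 4 := by
    rw [ha]; field_simp; ring
  rw [h6]
  linarith

end Hitting

/-! ### Dynamic programming costs and the endgame with few vertices left. -/

section Cost

variable {V : Type*} [Fintype V] [DecidableEq V] {G : SimpleGraph V} [DecidableRel G.Adj]

theorem nonempty_neighborSet (hd : ∀ x, 0 < G.degree x) (x : V) : Nonempty (G.neighborSet x) := by
  obtain ⟨y, hy⟩ := (G.degree_pos_iff_exists_adj x).1 (hd x)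
  exact ⟨⟨y, hy⟩⟩

theorem iInf_neighborSet_le {x y : V} (f : V → ℝ) (hy : G.Adj x y) :
    ⨅ z : G.neighborSet x, f z ≤ f y :=
  ciInf_le (Set.finite_range fun z : G.neighborSet x => f z).bddBelow (⟨y, hy⟩ : G.neighborSet x)

theorem iInf_neighborSet_le_srw (hd : ∀ x, 0 < G.degree x) (f : V → ℝ) (x : V) :
    ⨅ z : G.neighborSet x, f z ≤ (srwMatrix G *ᵥ f) x := by
  conv_lhs => rw [← srw_mulVec_const hd (⨅ z : G.neighborSet x, f z) x]
  exact srw_mulVec_mono fun y hy => iInf_neighborSet_le f hy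

variable (G) in
/-- Optimal expected number of steps spent before covering, up to the horizon `n`, for the walk
at `x` when `U` is the set of vertices not visited yet. -/
def cost (ε : ℝ) : ℕ → Finset V → V → ℝ
  | 0, _, _ => 0
  | n + 1, U, x => if U = ∅ then 0 else
      1 + (1 - ε) * (srwMatrix G *ᵥ fun y => cost ε n (U.erase y) y) x +
        ε * ⨅ y : G.neighborSet x, cost ε n (U.erase y) y

variable {ε : ℝ}

theorem cost_empty (n : ℕ) (x : V) : cost G ε n ∅ x = 0 := by
  cases n <;> simp [cost]

theorem cost_succ {U : Finset V} (hU : U.Nonempty) (n : ℕ) (x : V) :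
    cost G ε (n + 1) U x =
      1 + (1 - ε) * (srwMatrix G *ᵥ fun y => cost G ε n (U.erase y) y) x +
        ε * ⨅ y : G.neighborSet x, cost G ε n (U.erase y) y := by
  rw [cost, if_neg hU.ne_empty]

theorem cost_le_succ (hd : ∀ x, 0 < G.degree x) (h0 : 0 ≤ ε) (h1 : ε ≤ 1) (n : ℕ) (U : Finset V)
    (x : V) : cost G ε n U x ≤ cost G ε (n + 1) U x := by
  have h1' : 0 ≤ 1 - ε := sub_nonneg.2 h1
  rcases U.eq_empty_or_nonempty with rfl | hU
  · simp [cost_empty]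
  induction n generalizing U x with
  | zero =>
    have := nonempty_neighborSet hd x
    rw [cost_succ hU]
    simp only [cost]
    rw [srw_mulVec_const hd]
    simp
  | succ n ih =>
    have ih' : ∀ y, cost G ε n (U.erase y) y ≤ cost G ε (n + 1) (U.erase y) y := fun y => by
      rcases (U.erase y).eq_empty_or_nonempty with h | h
      · simp [h, cost_empty]
      · exact ih _ _ h
    have := nonempty_neighborSet hd x
    rw [cost_succ hU, cost_succ hU]
    have e1 := srw_mulVec_mono (x := x) (G := G) fun y _ => ih' y
    have e2 : ⨅ y : G.neighborSet x, cost G ε n (U.erase y) y ≤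
        ⨅ y : G.neighborSet x, cost G ε (n + 1) (U.erase y) y :=
      ciInf_mono (Set.finite_range _).bddBelow fun y => ih' y
    gcongr

theorem cost_monotone (hd : ∀ x, 0 < G.degree x) (h0 : 0 ≤ ε) (h1 : ε ≤ 1) (U : Finset V)
    (x : V) : Monotone fun n => cost G ε n U x :=
  monotone_nat_of_le_succ fun n => cost_le_succ hd h0 h1 n U x

theorem cost_nonneg (hd : ∀ x, 0 < G.degree x) (h0 : 0 ≤ ε) (h1 : ε ≤ 1) (n : ℕ) (U : Finset V)
    (x : V) : 0 ≤ cost G ε n U x :=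
  cost_monotone hd h0 h1 U x (Nat.zero_le n)

/-- Averages of the concave function `q ↦ q ^ (1 - ε)`, written `q / q ^ ε` so that it vanishes
at `0` for `ε = 1` too: the gain of a controller that picks the best neighbour with
probability `ε`. -/
theorem boost_le (hd : ∀ x, 0 < G.degree x) (h0 : 0 ≤ ε) (h1 : ε ≤ 1) {q : V → ℝ}
    (hq : ∀ y, 0 ≤ q y) {x z : V} (hz : ∀ y, G.Adj x y → q y ≤ q z) :
    (srwMatrix G *ᵥ q) x / (srwMatrix G *ᵥ q) x ^ ε ≤
      (1 - ε) * (srwMatrix G *ᵥ fun y => q y / q y ^ ε) x + ε * (q z / q z ^ ε) := by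
  have h1' : 0 ≤ 1 - ε := sub_nonneg.2 h1
  have hnn : 0 ≤ (srwMatrix G *ᵥ fun y => q y / q y ^ ε) x :=
    Finset.sum_nonneg fun y _ => mul_nonneg (srw_nonneg x y)
      (div_nonneg (hq y) (Real.rpow_nonneg (hq y) _))
  have hzz : 0 ≤ q z / q z ^ ε := div_nonneg (hq z) (Real.rpow_nonneg (hq z) _)
  set a := (srwMatrix G *ᵥ q) x with ha
  have ha0 : 0 ≤ a := Finset.sum_nonneg fun y _ => mul_nonneg (srw_nonneg x y) (hq y)
  have haz : a ≤ q z := (srw_mulVec_mono hz).trans_eq (srw_mulVec_const hd (q z) x)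
  rcases ha0.eq_or_lt with h | hapos
  · rw [← h, zero_div]
    positivity
  have hzpos : 0 < q z := hapos.trans_le haz
  have hze : 0 < q z ^ ε := Real.rpow_pos_of_pos hzpos _
  have hae : 0 < a ^ ε := Real.rpow_pos_of_pos hapos _
  have h2 : a / q z ^ ε ≤ (srwMatrix G *ᵥ fun y => q y / q y ^ ε) x := by
    have e : a / q z ^ ε = (srwMatrix G *ᵥ fun y => q y / q z ^ ε) x := by
      simp only [ha, mulVec, dotProduct, Finset.sum_div, mul_div_assoc]
    rw [e]
    refine srw_mulVec_mono fun y hy => ?_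
    rcases (hq y).eq_or_lt with h | hy0
    · simp [← h]
    · exact div_le_div_of_nonneg_left hy0.le (Real.rpow_pos_of_pos hy0 _)
        (Real.rpow_le_rpow hy0.le (hz y hy) h0)
  -- The best value `q z` bounds the others, so `q y / q y ^ ε ≥ q y / q z ^ ε`, which is linear in
  -- `q y` and averages to `a / q z ^ ε`. Weighted AM–GM for `a` and `q z`, divided by `q z ^ ε`,
  -- gives the claim.
  have h3 := Real.geom_mean_le_arith_mean2_weighted h1' h0 ha0 hzpos.le (by ring)
  rw [Real.rpow_sub hapos, Real.rpow_one] at h3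
  calc a / a ^ ε = a / a ^ ε * q z ^ ε / q z ^ ε := by field_simp
    _ ≤ ((1 - ε) * a + ε * q z) / q z ^ ε := by gcongr
    _ = (1 - ε) * (a / q z ^ ε) + ε * (q z / q z ^ ε) := by ring
    _ ≤ _ := by gcongr

/-- Here `d` is the extra price of not having hit `U` within `j` steps. Steering to the neighbour of
largest `hitProb` saves it with probability at least `q ^ (1 - ε)`, by `boost_le` at each step. -/
theorem cost_add_le_of_hit (hd : ∀ x, 0 < G.degree x) (h0 : 0 ≤ ε) (h1 : ε ≤ 1) {U : Finset V}
    (hU : U.Nonempty) {F d : ℝ} (hd0 : 0 ≤ d) (hF : ∀ n, ∀ y ∈ U, cost G ε n (U.erase y) y ≤ F)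
    {m : ℕ} (hm : ∀ x ∉ U, cost G ε m U x ≤ F + d) (j : ℕ) {x : V} (hx : x ∉ U) :
    cost G ε (m + j) U x ≤ j + F + (1 - hitProb G U j x / hitProb G U j x ^ ε) * d := by
  have h1' : 0 ≤ 1 - ε := sub_nonneg.2 h1
  induction j generalizing x with
  | zero => simpa [hitProb, hx] using hm x hx
  | succ j ih =>
    set q := hitProb G U j with hq
    set c : V → ℝ := fun y => j + F + (1 - q y / q y ^ ε) * d with hc
    have hcost : ∀ y, cost G ε (m + j) (U.erase y) y ≤ c y := by
      intro y
      by_cases hy : y ∈ U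
      · refine (hF _ y hy).trans ?_
        simp [hc, hq, hitProb_of_mem hy]
      · rw [Finset.erase_eq_of_notMem hy]
        exact ih hy
    obtain ⟨y0, hy0⟩ := nonempty_neighborSet hd x
    obtain ⟨z, hzmem, hz⟩ := Finset.exists_max_image (G.neighborFinset x) q
      ⟨y0, (G.mem_neighborFinset x y0).2 hy0⟩
    have hxz : G.Adj x z := (G.mem_neighborFinset x z).1 hzmem
    have hb := boost_le hd h0 h1 (hitProb_nonneg U j) (x := x) (z := z)
      fun y hy => hz y ((G.mem_neighborFinset x y).2 hy)
    have hqx : hitProb G U (j + 1) x = (srwMatrix G *ᵥ q) x := by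
      rw [hitProb, if_neg hx]
    have e1 : (srwMatrix G *ᵥ fun y => cost G ε (m + j) (U.erase y) y) x ≤
        j + F + d - d * (srwMatrix G *ᵥ fun y => q y / q y ^ ε) x := by
      refine (srw_mulVec_mono fun y _ => hcost y).trans_eq ?_
      have : c = (fun _ => j + F + d) - d • fun y => q y / q y ^ ε := by
        ext y
        simp only [hc, Pi.sub_apply, Pi.smul_apply, smul_eq_mul]
        ring
      rw [this, mulVec_sub, mulVec_smul, Pi.sub_apply, srw_mulVec_const hd]
      simp
    have e2 : ⨅ y : G.neighborSet x, cost G ε (m + j) (U.erase y) y ≤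
        j + F + (1 - q z / q z ^ ε) * d :=
      (iInf_neighborSet_le (fun y => cost G ε (m + j) (U.erase y) y) hxz).trans (hcost z)
    rw [← add_assoc, cost_succ hU, hqx]
    have e3 := mul_le_mul_of_nonneg_left e1 h1'
    have e4 := mul_le_mul_of_nonneg_left e2 h0
    have e5 := mul_le_mul_of_nonneg_left hb hd0
    push_cast
    linarith

theorem div_rpow_mono (h1 : ε ≤ 1) {a b : ℝ} (ha : 0 < a) (hab : a ≤ b) :
    a / a ^ ε ≤ b / b ^ ε := by
  have e : ∀ {t : ℝ}, 0 < t → t / t ^ ε = t ^ (1 - ε) := fun ht => by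
    rw [Real.rpow_sub ht, Real.rpow_one]
  rw [e ha, e (ha.trans_le hab)]
  exact Real.rpow_le_rpow ha.le hab (sub_nonneg.2 h1)

/-- Discrete form of `∫ t ^ (ε - 1) = t ^ ε / ε`, from Bernoulli's inequality `(1 - 1 / t) ^ ε ≤ 1 -
ε / t`. It sums the costs of successive new vertices. -/
theorem rpow_div_add_le (h0 : 0 < ε) (h1 : ε ≤ 1) (s : ℕ) :
    (s : ℝ) ^ ε / ε + ((s + 1 : ℕ) : ℝ) ^ ε / ((s + 1 : ℕ) : ℝ) ≤ ((s + 1 : ℕ) : ℝ) ^ ε / ε := by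
  set t : ℝ := ((s + 1 : ℕ) : ℝ) with ht
  have ht0 : 0 < t := by positivity
  have hs : (s : ℝ) = t * (1 + -(1 / t)) := by
    rw [ht]; push_cast; field_simp; ring
  have ht1 : 1 / t ≤ 1 := by
    rw [div_le_one ht0, ht]; push_cast; linarith [(Nat.cast_nonneg s : (0 : ℝ) ≤ s)]
  have h2 := rpow_one_add_le_one_add_mul_self (s := -(1 / t)) (by linarith) h0.le h1
  rw [hs, Real.mul_rpow ht0.le (by linarith)]
  have h3 := mul_le_mul_of_nonneg_left h2 (Real.rpow_nonneg ht0.le ε)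
  calc t ^ ε * (1 + -(1 / t)) ^ ε / ε + t ^ ε / t ≤
      t ^ ε * (1 + ε * -(1 / t)) / ε + t ^ ε / t := by gcongr
    _ = t ^ ε / ε := by field_simp; ring

/-- Cost of covering a set of at most `m` remaining vertices. -/
theorem cost_le_of_card_le (hd : ∀ x, 0 < G.degree x) (h0 : 0 < ε) (h1 : ε ≤ 1) {B m : ℕ}
    (hB : 0 < B) {p : ℝ} (hp : 0 < p)
    (hhit : ∀ S : Finset V, S.Nonempty → S.card ≤ m → ∀ x, p * S.card ≤ hitProb G S B x)
    (n : ℕ) (U : Finset V) (hUm : U.card ≤ m) {x : V} (hx : x ∉ U) :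
    cost G ε n U x ≤ B * p ^ ε / p * ((U.card : ℝ) ^ ε / ε) := by
  obtain ⟨s, hs⟩ : ∃ s, U.card = s := ⟨_, rfl⟩
  induction s generalizing n U x with
  | zero =>
    rw [Finset.card_eq_zero] at hs
    subst hs
    rw [cost_empty]
    positivity
  | succ s ih =>
    have hU : U.Nonempty := by rw [← Finset.card_pos, hs]; omega
    set A : ℝ := B * p ^ ε / p with hA
    have hA0 : 0 < A := by positivity
    set F : ℝ := A * ((s : ℝ) ^ ε / ε) with hFdef
    set t : ℝ := ((s + 1 : ℕ) : ℝ) with ht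
    have ht0 : 0 < t := by positivity
    set d : ℝ := A * (t ^ ε / t) with hddef
    have hd0 : 0 ≤ d := by positivity
    have hF : ∀ n, ∀ y ∈ U, cost G ε n (U.erase y) y ≤ F := by
      intro n y hy
      have hc : (U.erase y).card = s := by rw [Finset.card_erase_of_mem hy, hs]; rfl
      have := ih n (U.erase y) (by omega) (Finset.notMem_erase y U) hc
      rwa [hc] at this
    -- The value of `d` solves `(p t) ^ (1 - ε) * d = B`: the expected saving over a block pays for
    -- its `B` steps, so the bound `F + d` reproduces itself from block to block.
    have hprob : ∀ x, B ≤ hitProb G U B x / hitProb G U B x ^ ε * d := by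
      intro x
      have h2 := hhit U hU hUm x
      rw [hs] at h2
      have h3 := div_rpow_mono h1 (by positivity : 0 < p * t) h2
      calc (B : ℝ) = (p * t) / (p * t) ^ ε * d := by
            rw [hddef, hA, Real.mul_rpow hp.le ht0.le]
            field_simp
        _ ≤ _ := by gcongr
    have hblock : ∀ i : ℕ, ∀ x ∉ U, cost G ε (i * B) U x ≤ F + d := by
      intro i
      induction i with
      | zero =>
        intro x _
        rw [Nat.zero_mul, cost]
        positivity
      | succ i ihi =>
        intro x hx
        have := cost_add_le_of_hit hd h0.le h1 hU hd0 hF ihi B hx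
        rw [Nat.succ_mul]
        refine this.trans ?_
        linarith [hprob x]
    have h4 := (cost_monotone hd h0.le h1 U x (Nat.le_mul_of_pos_right n hB)).trans (hblock n x hx)
    rw [hs]
    refine h4.trans ?_
    rw [hFdef, hddef, ← mul_add]
    exact mul_le_mul_of_nonneg_left (rpow_div_add_le h0 h1 s) hA0.le

/-! ### The opening phase, in which the controller imitates the simple random walk. -/

variable (G) in
/-- One step of the simple random walk, acting on functions of the unvisited set and the
position. -/
def srwStep : Module.End ℝ (Finset V → V → ℝ) where
  toFun f U x := (srwMatrix G *ᵥ fun y => f (U.erase y) y) x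
  map_add' f g := by
    ext U x
    exact congrFun (mulVec_add (srwMatrix G) (fun y => f (U.erase y) y)
      fun y => g (U.erase y) y) x
  map_smul' c f := by
    ext U x
    exact congrFun (mulVec_smul (srwMatrix G) c fun y => f (U.erase y) y) x

theorem srwStep_pow_succ (f : Finset V → V → ℝ) (j : ℕ) (U : Finset V) (x : V) :
    (srwStep G ^ (j + 1)) f U x =
      (srwMatrix G *ᵥ fun y => (srwStep G ^ j) f (U.erase y) y) x := by
  rw [pow_succ']
  rfl

theorem srwStep_pow_mono {f g : Finset V → V → ℝ} (h : ∀ U, ∀ x ∉ U, f U x ≤ g U x) (j : ℕ)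
    {U : Finset V} {x : V} (hx : x ∉ U) : (srwStep G ^ j) f U x ≤ (srwStep G ^ j) g U x := by
  induction j generalizing U x with
  | zero => exact h U x hx
  | succ j ih =>
    rw [srwStep_pow_succ, srwStep_pow_succ]
    exact srw_mulVec_mono fun y _ => ih (Finset.notMem_erase y U)

theorem srwStep_pow_const (hd : ∀ x, 0 < G.degree x) (c : ℝ) (j : ℕ) (U : Finset V) (x : V) :
    (srwStep G ^ j) (fun _ _ => c) U x = c := by
  induction j generalizing U x with
  | zero => rfl
  | succ j ih => simp only [srwStep_pow_succ, ih, srw_mulVec_const hd]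

theorem srwStep_pow_nonneg (hd : ∀ x, 0 < G.degree x) {f : Finset V → V → ℝ}
    (h : ∀ U x, 0 ≤ f U x) (j : ℕ) {U : Finset V} {x : V} (hx : x ∉ U) :
    0 ≤ (srwStep G ^ j) f U x :=
  (srwStep_pow_const hd 0 j U x).symm.le.trans (srwStep_pow_mono (fun U x _ => h U x) j hx)

/-- The best neighbour is no worse than the average one, so following the simple random walk for `j`
steps bounds the optimum. -/
theorem cost_add_le_srwStep (hd : ∀ x, 0 < G.degree x) (h0 : 0 ≤ ε) (h1 : ε ≤ 1) (m j : ℕ)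
    {U : Finset V} {x : V} (hx : x ∉ U) :
    cost G ε (m + j) U x ≤ j + (srwStep G ^ j) (cost G ε m) U x := by
  induction j generalizing U x with
  | zero => simp
  | succ j ih =>
    rcases U.eq_empty_or_nonempty with rfl | hU
    · rw [cost_empty]
      have := srwStep_pow_nonneg hd (cost_nonneg hd h0 h1 m) (j + 1) hx
      positivity
    · rw [← add_assoc, cost_succ hU, srwStep_pow_succ]
      have e1 := iInf_neighborSet_le_srw hd (fun y => cost G ε (m + j) (U.erase y) y) x
      have e2 : (srwMatrix G *ᵥ fun y => cost G ε (m + j) (U.erase y) y) x ≤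
          j + (srwMatrix G *ᵥ fun y => (srwStep G ^ j) (cost G ε m) (U.erase y) y) x := by
        refine (srw_mulVec_mono fun y _ => ih (Finset.notMem_erase y U)).trans_eq ?_
        have : (fun y => j + (srwStep G ^ j) (cost G ε m) (U.erase y) y) = (fun _ => (j : ℝ)) +
            fun y => (srwStep G ^ j) (cost G ε m) (U.erase y) y := rfl
        rw [this, mulVec_add, Pi.add_apply, srw_mulVec_const hd]
      have e3 := mul_le_mul_of_nonneg_left e1 h0
      push_cast
      linarith

/-- The indicator that `v` is unvisited. -/
def unvisited (v : V) : Finset V → V → ℝ := fun U _ => if v ∈ U then 1 else 0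

theorem srwStep_pow_unvisited_of_notMem (v : V) (j : ℕ) {U : Finset V} (hv : v ∉ U) (x : V) :
    (srwStep G ^ j) (unvisited v) U x = 0 := by
  induction j generalizing U x with
  | zero => simp [unvisited, hv]
  | succ j ih =>
    rw [srwStep_pow_succ]
    refine Finset.sum_eq_zero fun y _ => ?_
    exact mul_eq_zero_of_right _ (ih (fun h => hv (Finset.mem_of_mem_erase h)) y)

theorem srwStep_pow_unvisited_le_hitProb (hd : ∀ x, 0 < G.degree x) (v : V) (j : ℕ)
    {U : Finset V} {x : V} (hx : x ∉ U) :
    (srwStep G ^ j) (unvisited v) U x ≤ 1 - hitProb G {v} j x := by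
  induction j generalizing U x with
  | zero =>
    by_cases hv : v ∈ U
    · have : x ≠ v := fun h => hx (h ▸ hv)
      simp [unvisited, hv, hitProb, this]
    · simp only [pow_zero, Module.End.one_apply, unvisited, hv, if_false]
      linarith [hitProb_le_one hd {v} 0 x]
  | succ j ih =>
    by_cases hv : x = v
    · subst hv
      rw [srwStep_pow_unvisited_of_notMem _ _ hx]
      linarith [hitProb_le_one hd {x} (j + 1) x]
    · rw [srwStep_pow_succ]
      refine (srw_mulVec_mono fun y _ => ih (Finset.notMem_erase y U)).trans_eq ?_
      have : (fun y => 1 - hitProb G {v} j y) = (fun _ => (1 : ℝ)) - hitProb G {v} j := rfl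
      rw [this, mulVec_sub, Pi.sub_apply, srw_mulVec_const hd, hitProb, if_neg (by simpa using hv)]

/-- Markov property over blocks of length `B`: each block misses `v` with conditional probability at
most `1 - p`. -/
theorem srwStep_pow_mul_unvisited_le (hd : ∀ x, 0 < G.degree x) {v : V} {B : ℕ} {p : ℝ}
    (hp : ∀ x, p ≤ hitProb G {v} B x) (k : ℕ) {U : Finset V} {x : V} (hx : x ∉ U) :
    (srwStep G ^ (B * k)) (unvisited v) U x ≤ (1 - p) ^ k * unvisited v U x := by
  have hp1 : 0 ≤ 1 - p := sub_nonneg.2 ((hp v).trans (hitProb_le_one hd _ _ _))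
  have hone : ∀ (U : Finset V), ∀ x ∉ U,
      (srwStep G ^ B) (unvisited v) U x ≤ (1 - p) * unvisited v U x := by
    intro U x hx
    by_cases hv : v ∈ U
    · refine (srwStep_pow_unvisited_le_hitProb hd v B hx).trans ?_
      simp only [unvisited, hv, if_true]
      linarith [hp x]
    · rw [srwStep_pow_unvisited_of_notMem v B hv]
      simp [unvisited, hv]
  induction k generalizing U x with
  | zero => simp
  | succ k ih =>
    have e : (srwStep G ^ (B * (k + 1))) (unvisited v) U x =
        (srwStep G ^ B) ((srwStep G ^ (B * k)) (unvisited v)) U x := by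
      rw [Nat.mul_succ, add_comm, pow_add]
      rfl
    rw [e]
    refine (srwStep_pow_mono (g := (1 - p) ^ k • unvisited v)
      (fun U x hx => ih hx) B hx).trans ?_
    rw [map_smul]
    change (1 - p) ^ k * (srwStep G ^ B) (unvisited v) U x ≤ _
    have := mul_le_mul_of_nonneg_left (hone U x hx) (pow_nonneg hp1 k)
    rw [pow_succ, mul_assoc]
    exact this

/-- A bound for the optimal cost: run the simple random walk for `B * k` steps until at most `m`
vertices are left. -/
theorem cost_le_of_srw (hd : ∀ x, 0 < G.degree x) (h0 : 0 ≤ ε) (h1 : ε ≤ 1) {B k m : ℕ}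
    (hBk : 0 < B * k) {p F : ℝ} (hF0 : 0 ≤ F) (hp : ∀ v x, p ≤ hitProb G {v} B x)
    (hF : ∀ n (U : Finset V), U.card ≤ m → ∀ x ∉ U, cost G ε n U x ≤ F)
    (hk : (1 - p) ^ k * Fintype.card V ≤ (m + 1) / 2)
    (n : ℕ) (U : Finset V) {x : V} (hx : x ∉ U) :
    cost G ε n U x ≤ 2 * ((B * k : ℕ) + F) := by
  set L := B * k with hL
  set M : ℝ := 2 * (L + F) with hM
  have hM0 : 0 ≤ M := by positivity
  have hm0 : (0 : ℝ) < m + 1 := by positivity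
  have hblock : ∀ i : ℕ, ∀ U : Finset V, ∀ x ∉ U, cost G ε (i * L) U x ≤ M := by
    intro i
    induction i with
    | zero =>
      intro U x _
      rw [Nat.zero_mul, cost]
      exact hM0
    | succ i ih =>
      intro U x hx
      -- Markov's inequality in pointwise form: when more than `m` vertices remain, `|U| / (m + 1) ≥
      -- 1` pays for the full bound `M`. The mean of `|U|` after `L` steps is at most `(m + 1) / 2`,
      -- which leaves `L + F + M / 2 = M`.
      have h2 : ∀ U : Finset V, ∀ x ∉ U, cost G ε (i * L) U x ≤
          ((fun _ _ => F) + (M / (m + 1)) • ∑ v, unvisited v : Finset V → V → ℝ) U x := by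
        intro U x hx
        have hsum : (∑ v, unvisited v : Finset V → V → ℝ) U x = U.card := by
          rw [Finset.sum_apply, Finset.sum_apply]
          simp [unvisited]
        simp only [Pi.add_apply, Pi.smul_apply, smul_eq_mul]
        rw [hsum]
        by_cases hc : U.card ≤ m
        · have := hF (i * L) U hc x hx
          have : 0 ≤ M / (m + 1) * (U.card : ℝ) := by positivity
          linarith
        · have h3 : (m + 1 : ℝ) ≤ U.card := by exact_mod_cast not_le.1 hc
          have h4 : M ≤ M / (m + 1) * (U.card : ℝ) := by
            rw [div_mul_eq_mul_div, le_div_iff₀ hm0]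
            gcongr
          linarith [ih U x hx]
      have h3 := cost_add_le_srwStep hd h0 h1 (i * L) L hx
      have h4 := srwStep_pow_mono (G := G) h2 L hx
      rw [map_add, map_smul, map_sum] at h4
      simp only [Pi.add_apply, Pi.smul_apply, smul_eq_mul, Finset.sum_apply] at h4
      rw [srwStep_pow_const hd] at h4
      have h5 : ∑ v, (srwStep G ^ L) (unvisited v) U x ≤ (m + 1) / 2 := by
        refine le_trans ?_ hk
        have : ∀ v ∈ Finset.univ, (srwStep G ^ L) (unvisited v) U x ≤ (1 - p) ^ k := by
          intro v _
          refine (srwStep_pow_mul_unvisited_le hd (hp v) k hx).trans ?_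
          have hp1 : 0 ≤ 1 - p := sub_nonneg.2 ((hp v v).trans (hitProb_le_one hd _ _ _))
          refine mul_le_of_le_one_right (pow_nonneg hp1 k) ?_
          simp only [unvisited]
          split_ifs <;> norm_num
        refine (Finset.sum_le_card_nsmul _ _ _ this).trans_eq ?_
        rw [nsmul_eq_mul, mul_comm, Finset.card_univ]
      have h6 := mul_le_mul_of_nonneg_left h5 (div_nonneg hM0 hm0.le)
      have h7 : M / (m + 1) * ((m + 1) / 2) = L + F := by
        rw [hM]; field_simp
      rw [Nat.succ_mul]
      have : M = 2 * (L + F) := hM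
      linarith
  exact (cost_monotone hd h0 h1 U x (Nat.le_mul_of_pos_right n hBk)).trans (hblock n U x hx)

end Cost

open MeasureTheory ProbabilityTheory

/-! ### From finite-horizon costs to the law of the controlled walk. -/

section Greedy

variable {V : Type*} [Fintype V] [DecidableEq V] {G : SimpleGraph V} [DecidableRel G.Adj]

/-- The vertices not visited by the history `h`. -/
def remaining {t : ℕ} (h : (i : Finset.Iic t) → V) : Finset V :=
  Finset.univ.filter fun v => ∀ i, h i ≠ v

/-- The current position of the walk with history `h`. -/
def position {t : ℕ} (h : (i : Finset.Iic t) → V) : V := h ⟨t, Finset.mem_Iic.2 le_rfl⟩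

theorem position_notMem_remaining {t : ℕ} (h : (i : Finset.Iic t) → V) :
    position h ∉ remaining h := by
  simp only [remaining, Finset.mem_filter, Finset.mem_univ, true_and, not_forall, not_not]
  exact ⟨_, rfl⟩

theorem mem_remaining_frestrictLe {t : ℕ} {ω : ℕ → V} {v : V} :
    v ∈ remaining (Preorder.frestrictLe (π := fun _ => V) t ω) ↔ ∀ s ≤ t, ω s ≠ v := by
  simp [remaining]

theorem remaining_frestrictLe_succ (t : ℕ) (ω : ℕ → V) :
    remaining (Preorder.frestrictLe (π := fun _ => V) (t + 1) ω) =
      (remaining (Preorder.frestrictLe (π := fun _ => V) t ω)).erase (ω (t + 1)) := by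
  ext v
  rw [Finset.mem_erase, mem_remaining_frestrictLe, mem_remaining_frestrictLe]
  constructor
  · exact fun h => ⟨(h _ le_rfl).symm, fun s hs => h s (hs.trans t.le_succ)⟩
  · rintro ⟨h1, h2⟩ s hs
    rcases Nat.le_succ_iff.1 hs with h | rfl
    · exact h2 s h
    · exact h1.symm

/-- The strategy that pushes the walk from `x` to `b U x` when `U` is the set of remaining
vertices. -/
def greedyStrategy (b : Finset V → V → V) (hb : ∀ U x, G.Adj x (b U x)) : Strategy G where
  bias _ h := Matrix.of fun x y => if y = b (remaining h) x then 1 else 0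
  stochastic t h := by
    rw [Matrix.mem_rowStochastic_iff_sum]
    refine ⟨fun x y => ?_, fun x => by simp⟩
    simp only [of_apply]
    split_ifs <;> norm_num
  supported t h x y hxy := by
    simp only [of_apply] at hxy
    split_ifs at hxy with h1
    · rw [h1]; exact hb _ _
    · exact absurd rfl hxy

theorem sum_greedyStrategy_stepMatrix (b : Finset V → V → V) (hb : ∀ U x, G.Adj x (b U x))
    (ε : unitInterval) {t : ℕ} (h : (i : Finset.Iic t) → V) (x : V) (f : V → ℝ) :
    ∑ y, (greedyStrategy b hb).stepMatrix ε t h x y * f y =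
      (1 - (ε : ℝ)) * (srwMatrix G *ᵥ f) x + ε * f (b (remaining h) x) := by
  simp only [Strategy.stepMatrix, greedyStrategy, Matrix.add_apply, Matrix.smul_apply, of_apply,
    smul_eq_mul, mulVec, dotProduct, add_mul, Finset.sum_add_distrib, Finset.mul_sum]
  congr 1
  · exact Finset.sum_congr rfl fun y _ => by ring
  · simp

theorem coveringTime_le_tsum (ω : ℕ → V) :
    ((coveringTime ω : ℕ∞) : ENNReal) ≤ ∑' t : ℕ,
      if (remaining (Preorder.frestrictLe (π := fun _ => V) t ω)).Nonempty then 1 else 0 := by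
  classical
  by_cases hc : ∃ t : ℕ, ∀ v, ∃ s ≤ t, ω s = v
  · have hle : coveringTime ω ≤ (Nat.find hc : ℕ∞) := iInf₂_le _ (Nat.find_spec hc)
    refine (ENat.toENNReal_mono hle).trans ?_
    refine le_trans ?_ (ENNReal.sum_le_tsum (Finset.range (Nat.find hc)))
    rw [ENat.toENNReal_coe, Finset.sum_congr rfl (g := fun _ => (1 : ENNReal))]
    · simp
    · intro t ht
      have := Nat.find_min hc (Finset.mem_range.1 ht)
      push Not at this
      obtain ⟨v, hv⟩ := this
      exact if_pos ⟨v, mem_remaining_frestrictLe.2 hv⟩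
  · push Not at hc
    have : ∀ t, (remaining (Preorder.frestrictLe (π := fun _ => V) t ω)).Nonempty := fun t => by
      obtain ⟨v, hv⟩ := hc t
      exact ⟨v, mem_remaining_frestrictLe.2 hv⟩
    simp [this]

variable [MeasurableSpace V] [DiscreteMeasurableSpace V]

theorem lintegral_stepKernel (σ : Strategy G) (ε : unitInterval) {t : ℕ}
    (h : (i : Finset.Iic t) → V) (f : V → ENNReal) :
    ∫⁻ y, f y ∂σ.stepKernel ε t h =
      ∑ y, ENNReal.ofReal (σ.stepMatrix ε t h (position h) y) * f y := by
  change ∫⁻ y, f y ∂(∑ y, ENNReal.ofReal (σ.stepMatrix ε t h (position h) y) •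
    Measure.dirac y) = _
  rw [lintegral_finsetSum_measure]
  simp [lintegral_smul_measure]

/-- Elapsed uncovered time plus `W` of the current state is a supermartingale. Its expectation never
exceeds the initial `W`, and letting time tend to infinity bounds the covering time. -/
theorem lintegral_coveringTime_le {ε : unitInterval} {W : Finset V → V → ℝ}
    {b : Finset V → V → V} (hb : ∀ U x, G.Adj x (b U x)) (hW0 : ∀ U x, 0 ≤ W U x)
    (hWe : ∀ x, W ∅ x = 0)
    (hW : ∀ U : Finset V, U.Nonempty → ∀ x ∉ U,
      1 + ((1 - (ε : ℝ)) * (srwMatrix G *ᵥ fun y => W (U.erase y) y) x +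
        ε * W (U.erase (b U x)) (b U x)) ≤ W U x) (v : V) :
    ∫⁻ ω, ((coveringTime ω : ℕ∞) : ENNReal) ∂((greedyStrategy b hb).walkLaw ε v) ≤
      ENNReal.ofReal (W (Finset.univ.erase v) v) := by
  set σ := greedyStrategy b hb with hσ
  set κ : (t : ℕ) → Kernel ((i : Finset.Iic t) → V) V := fun t => σ.stepKernel ε t with hκ
  set x₀ : (i : Finset.Iic 0) → V := fun _ => v with hx₀
  set ind : (t : ℕ) → ((i : Finset.Iic t) → V) → ENNReal :=
    fun t h => if (remaining h).Nonempty then 1 else 0 with hind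
  set Φ : (t : ℕ) → ((i : Finset.Iic t) → V) → ENNReal :=
    fun t h => ENNReal.ofReal (W (remaining h) (position h)) with hΦ
  have hpoint : ∀ (t : ℕ) (h : (i : Finset.Iic t) → V),
      ind t h + ∫⁻ y, ENNReal.ofReal (W ((remaining h).erase y) y) ∂κ t h ≤ Φ t h := by
    intro t h
    rw [hκ, lintegral_stepKernel]
    have hQ := σ.stepMatrix_mem_rowStochastic ε t h
    rw [Matrix.mem_rowStochastic_iff_sum] at hQ
    have e : ∑ y, ENNReal.ofReal (σ.stepMatrix ε t h (position h) y) *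
        ENNReal.ofReal (W ((remaining h).erase y) y) =
        ENNReal.ofReal (∑ y, σ.stepMatrix ε t h (position h) y * W ((remaining h).erase y) y) := by
      rw [ENNReal.ofReal_sum_of_nonneg fun y _ => mul_nonneg (hQ.1 _ y) (hW0 _ _)]
      exact Finset.sum_congr rfl fun y _ => (ENNReal.ofReal_mul (hQ.1 _ y)).symm
    have hnn : 0 ≤ ∑ y, σ.stepMatrix ε t h (position h) y * W ((remaining h).erase y) y :=
      Finset.sum_nonneg fun y _ => mul_nonneg (hQ.1 _ y) (hW0 _ _)
    rw [e]
    rcases (remaining h).eq_empty_or_nonempty with hU | hU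
    · simp [hind, hU, hWe]
    · simp only [hind, hU, if_true, hΦ]
      rw [← ENNReal.ofReal_one, ← ENNReal.ofReal_add zero_le_one hnn]
      refine ENNReal.ofReal_le_ofReal ?_
      rw [hσ, sum_greedyStrategy_stepMatrix b hb ε h (position h)
        fun y => W ((remaining h).erase y) y]
      exact hW _ hU _ (position_notMem_remaining h)
  have hstep : ∀ t : ℕ, ∫⁻ h, Φ (t + 1) h ∂(Kernel.partialTraj (X := fun _ => V) κ 0 (t + 1) x₀) =
      ∫⁻ h : (i : Finset.Iic t) → V, ∫⁻ y, ENNReal.ofReal (W ((remaining h).erase y) y) ∂κ t h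
        ∂(Kernel.partialTraj (X := fun _ => V) κ 0 t x₀) := by
    intro t
    rw [← Measure.lintegral_compProd (f := fun p : ((i : Finset.Iic t) → V) × V =>
      ENNReal.ofReal (W ((remaining p.1).erase p.2) p.2)) (.of_discrete),
      Kernel.partialTraj_compProd_eq_map_traj (X := fun _ => V) (Nat.zero_le t),
      lintegral_map (.of_discrete) (by fun_prop),
      ← Kernel.traj_map_frestrictLe_apply, lintegral_map (.of_discrete) (by fun_prop)]
    refine lintegral_congr fun ω => ?_
    simp only [hΦ]
    rw [remaining_frestrictLe_succ]
    rfl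
  have hsum : ∀ t : ℕ, ∑ s ∈ Finset.range t, ∫⁻ h, ind s h ∂(Kernel.partialTraj (X := fun _ => V) κ 0 s x₀) +
      ∫⁻ h, Φ t h ∂(Kernel.partialTraj (X := fun _ => V) κ 0 t x₀) ≤
        ENNReal.ofReal (W (Finset.univ.erase v) v) := by
    intro t
    induction t with
    | zero =>
      rw [Finset.sum_range_zero, zero_add, Kernel.partialTraj_self, Kernel.id_apply,
        lintegral_dirac' _ (.of_discrete)]
      refine le_of_eq ?_
      have : remaining x₀ = Finset.univ.erase v := by
        ext w
        simp [remaining, hx₀, eq_comm]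
      simp only [hΦ, this]
      rfl
    | succ t ih =>
      rw [Finset.sum_range_succ, hstep, add_assoc, ← lintegral_add_left (.of_discrete)]
      exact (add_le_add_right (lintegral_mono (hpoint t)) _).trans ih
  calc ∫⁻ ω, ((coveringTime ω : ℕ∞) : ENNReal) ∂(σ.walkLaw ε v) ≤
      ∫⁻ ω, ∑' t : ℕ, ind t (Preorder.frestrictLe (π := fun _ => V) t ω)
        ∂(Kernel.traj (X := fun _ => V) κ 0 x₀) := lintegral_mono coveringTime_le_tsum
    _ = ∑' t : ℕ, ∫⁻ h, ind t h ∂(Kernel.partialTraj (X := fun _ => V) κ 0 t x₀) := by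
      rw [lintegral_tsum (f := fun t ω => ind t (Preorder.frestrictLe (π := fun _ => V) t ω)) fun t =>
        ((Measurable.of_discrete (f := ind t)).comp (by fun_prop)).aemeasurable]
      refine tsum_congr fun t => ?_
      rw [← Kernel.traj_map_frestrictLe_apply, lintegral_map (.of_discrete) (by fun_prop)]
    _ ≤ _ := ENNReal.tsum_le_of_sum_range_le fun t => le_self_add.trans (hsum t)

/-- A bound on all finite-horizon optimal costs bounds the cover time. -/
theorem coverTime_le_of_cost_le (hd : ∀ x, 0 < G.degree x) (ε : unitInterval) {M : ℝ}
    (hM : ∀ n (U : Finset V), ∀ x ∉ U, cost G ε n U x ≤ M) :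
    coverTime G ε ≤ ENNReal.ofReal M := by
  have h0 : (0 : ℝ) ≤ ε := ε.2.1
  have h1 : (ε : ℝ) ≤ 1 := ε.2.2
  have h1' : (0 : ℝ) ≤ 1 - ε := sub_nonneg.2 h1
  set W : Finset V → V → ℝ := fun U x => ⨆ n, cost G ε n U x with hWdef
  have hbdd : ∀ (U : Finset V), ∀ x ∉ U, BddAbove (Set.range fun n => cost G ε n U x) :=
    fun U x hx => ⟨M, by rintro _ ⟨n, rfl⟩; exact hM n U x hx⟩
  have hle : ∀ n (U : Finset V), ∀ x ∉ U, cost G ε n U x ≤ W U x :=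
    fun n U x hx => le_ciSup (hbdd U x hx) n
  have hex : ∀ (U : Finset V) (x : V), ∃ z, G.Adj x z ∧
      ∀ y, G.Adj x y → W (U.erase z) z ≤ W (U.erase y) y := by
    intro U x
    obtain ⟨y0, hy0⟩ := nonempty_neighborSet hd x
    obtain ⟨z, hz, hmin⟩ := Finset.exists_min_image (G.neighborFinset x)
      (fun y => W (U.erase y) y) ⟨y0, (G.mem_neighborFinset x y0).2 hy0⟩
    exact ⟨z, (G.mem_neighborFinset x z).1 hz, fun y hy =>
      hmin y ((G.mem_neighborFinset x y).2 hy)⟩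
  choose b hb hbmin using hex
  refine iSup_le fun v => (iInf_le _ (greedyStrategy b hb)).trans ?_
  refine (lintegral_coveringTime_le (W := W) hb (fun U x => ?_) (fun x => ?_) ?_ v).trans
    (ENNReal.ofReal_le_ofReal (ciSup_le fun n => hM n _ v (Finset.notMem_erase _ _)))
  -- For `x ∈ U` no upper bound on the costs is at hand, but the default supremum `0` of an
  -- unbounded family is nonnegative too.
  · exact Real.iSup_nonneg fun n => cost_nonneg hd h0 h1 n U x
  · simp [hWdef, cost_empty]
  intro U hU x hx
  -- There are finitely many vertices, so one horizon `m` is within `δ` of the supremum at all of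
  -- them, and the recursion for `cost` passes to the limit.
  refine le_of_forall_pos_le_add fun δ hδ => ?_
  have hconv : ∀ y, ∃ n, W (U.erase y) y - δ < cost G ε n (U.erase y) y := fun y =>
    exists_lt_of_lt_ciSup (sub_lt_self _ hδ)
  choose n hn using hconv
  set m := Finset.univ.sup n
  have hm : ∀ y, W (U.erase y) y - δ ≤ cost G ε m (U.erase y) y := fun y =>
    (hn y).le.trans (cost_monotone hd h0 h1 _ _ (Finset.le_sup (Finset.mem_univ y)))
  have e1 := hle (m + 1) U x hx
  rw [cost_succ hU] at e1
  have e2 : (srwMatrix G *ᵥ fun y => W (U.erase y) y) x - δ ≤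
      (srwMatrix G *ᵥ fun y => cost G ε m (U.erase y) y) x := by
    refine le_trans (le_of_eq ?_) (srw_mulVec_mono fun y _ => hm y)
    have : (fun y => W (U.erase y) y - δ) = (fun y => W (U.erase y) y) - fun _ => δ := rfl
    rw [this, mulVec_sub, Pi.sub_apply, srw_mulVec_const hd]
  have := nonempty_neighborSet hd x
  have e3 : W (U.erase (b U x)) (b U x) - δ ≤
      ⨅ y : G.neighborSet x, cost G ε m (U.erase y) y :=
    le_ciInf fun y => (sub_le_sub_right (hbmin U x y y.2) δ).trans (hm y)
  have e4 := mul_le_mul_of_nonneg_left e2 h1'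
  have e5 := mul_le_mul_of_nonneg_left e3 h0
  linarith

end Greedy

/-! ### Choice of parameters and conclusion. -/

/-- Cover time bound for an expander, with `T` an upper bound of the mixing time. -/
theorem coverTime_le_of_mixing {V : Type*} [Fintype V] [DecidableEq V] [MeasurableSpace V]
    [DiscreteMeasurableSpace V] {G : SimpleGraph V} [DecidableRel G.Adj] (hconn : G.Connected)
    (hd : ∀ x, 0 < G.degree x) {γ : ℝ} (hγ0 : 0 < γ) (hγ1 : γ ≤ 1)
    (hγ : lazySecondEigenvalue G ≤ 1 - γ) {D : ℕ} (hD : ∀ x, G.degree x ≤ D) {T : ℕ} (hT : 0 < T)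
    (hTn : T ≤ Fintype.card V)
    (hmix : (1 - γ) ^ T * (D * Fintype.card V) ≤ (γ / (8 * (D * Fintype.card V))) ^ 2)
    {ε : unitInterval} (hε : 0 < ε) :
    coverTime G ε ≤ ENNReal.ofReal (4 * T + 32 * D / γ * Fintype.card V * Real.log (2 * T) +
      32 * D / γ * (Fintype.card V / (ε : ℝ))) := by
  have h0 : (0 : ℝ) < ε := hε
  have h1 : (ε : ℝ) ≤ 1 := ε.2.2
  have hne := hconn.nonempty
  have hD0 : (1 : ℝ) ≤ D := by
    obtain ⟨x⟩ := hne
    exact_mod_cast (hd x).trans_le (hD x)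
  have hn : (0 : ℝ) < Fintype.card V := by exact_mod_cast Fintype.card_pos
  have hT1 : (1 : ℝ) ≤ T := by exact_mod_cast hT
  set N := Fintype.card V
  set p : ℝ := γ / (8 * D) * (T / N) with hp
  have hp0 : 0 < p := by positivity
  set m := N / T with hm
  set k := ⌈Real.log (2 * T) / p⌉₊ with hk
  have hlog : 0 < Real.log (2 * T) := Real.log_pos (by linarith)
  have hk0 : 0 < k := Nat.ceil_pos.2 (by positivity)
  have hhit : ∀ S : Finset V, S.Nonempty → S.card ≤ m → ∀ x,
      p * S.card ≤ hitProb G S (2 * T) x := by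
    intro S hS hSm x
    have hST : S.card * T ≤ N := (Nat.mul_le_mul_right T hSm).trans (Nat.div_mul_le_self N T)
    refine le_trans (le_of_eq ?_) (le_hitProb hconn hd hγ0 hγ1 hγ hD hT hmix hS hST x)
    rw [hp]
    ring
  have hm1 : 1 ≤ m := (Nat.one_le_div_iff hT).2 hTn
  have hsing : ∀ v x, p ≤ hitProb G {v} (2 * T) x := fun v x => by
    simpa using hhit {v} (Finset.singleton_nonempty v) (by simpa using hm1) x
  have hmT : (m : ℝ) * T ≤ N := by exact_mod_cast Nat.div_mul_le_self N T
  have hpm : p * m ≤ 1 := by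
    have e : p * m = γ / (8 * D) * (m * T / N) := by rw [hp]; ring
    rw [e]
    have e1 : (m : ℝ) * T / N ≤ 1 := by rwa [div_le_one hn]
    have e2 : γ / (8 * D) ≤ 1 := by rw [div_le_one (by positivity)]; linarith
    exact mul_le_one₀ e2 (by positivity) e1
  have hF : ∀ n (U : Finset V), U.card ≤ m → ∀ x ∉ U,
      cost G ε n U x ≤ 16 * D / γ * (N / (ε : ℝ)) := by
    intro n U hU x hx
    refine (cost_le_of_card_le hd h0 h1 (by omega) hp0 hhit n U hU hx).trans ?_
    -- The cutoff `m = N / T` makes `p |U| ≤ 1`, so only `2 T / (p ε)` survives.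
    have e1 : p ^ (ε : ℝ) * (U.card : ℝ) ^ (ε : ℝ) ≤ 1 := by
      rw [← Real.mul_rpow hp0.le (Nat.cast_nonneg _)]
      refine Real.rpow_le_one (by positivity) (le_trans ?_ hpm) h0.le
      gcongr
    calc ((2 * T : ℕ) : ℝ) * p ^ (ε : ℝ) / p * ((U.card : ℝ) ^ (ε : ℝ) / ε) =
        (2 * T) / (p * ε) * (p ^ (ε : ℝ) * (U.card : ℝ) ^ (ε : ℝ)) := by
          push_cast
          field_simp
      _ ≤ (2 * T) / (p * ε) * 1 := by gcongr
      _ = 16 * D / γ * (N / (ε : ℝ)) := by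
          rw [hp]
          field_simp
          ring
  have hkk : (1 - p) ^ k * N ≤ ((m : ℝ) + 1) / 2 := by
    have hp1 : 0 ≤ 1 - p := by
      obtain ⟨v⟩ := hne
      exact sub_nonneg.2 ((hsing v v).trans (hitProb_le_one hd _ _ _))
    have e1 : (1 - p) ^ k ≤ 1 / (2 * T) := by
      calc (1 - p) ^ k ≤ Real.exp (-p) ^ k :=
            pow_le_pow_left₀ hp1 (by linarith [Real.add_one_le_exp (-p)]) k
        _ = Real.exp (-(k * p)) := by rw [← Real.exp_nat_mul]; ring_nf
        _ ≤ Real.exp (-Real.log (2 * T)) := by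
            rw [Real.exp_le_exp, neg_le_neg_iff, ← div_le_iff₀ hp0]
            exact Nat.le_ceil _
        _ = 1 / (2 * T) := by rw [Real.exp_neg, Real.exp_log (by linarith), one_div]
    have e2 : (N : ℝ) ≤ T * (m + 1) := by
      exact_mod_cast (Nat.lt_mul_div_succ N hT).le
    calc (1 - p) ^ k * N ≤ 1 / (2 * T) * (T * (m + 1)) := by gcongr
      _ = _ := by field_simp
  refine (coverTime_le_of_cost_le hd ε fun n U x hx =>
    cost_le_of_srw hd h0.le h1 (by positivity) (by positivity) hsing hF hkk n U hx).trans ?_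
  refine ENNReal.ofReal_le_ofReal ?_
  have hkle : (k : ℝ) ≤ Real.log (2 * T) / p + 1 := (Nat.ceil_lt_add_one (by positivity)).le
  have e3 : ((2 * T * k : ℕ) : ℝ) ≤ 2 * T + 16 * D / γ * N * Real.log (2 * T) := by
    push_cast
    calc (2 : ℝ) * T * k ≤ 2 * T * (Real.log (2 * T) / p + 1) := by gcongr
      _ = _ := by
        rw [hp]
        field_simp
        ring
  have e4 : 32 * D / γ * (N / (ε : ℝ)) = 2 * (16 * D / γ * (N / (ε : ℝ))) := by ring
  have e5 : 32 * D / γ * N * Real.log (2 * T) = 2 * (16 * D / γ * N * Real.log (2 * T)) := by ring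
  rw [e4, e5]
  linarith

theorem coverTime_le_loglog {V : Type*} [Fintype V] [DecidableEq V] [MeasurableSpace V]
    [DiscreteMeasurableSpace V] {G : SimpleGraph V} [DecidableRel G.Adj] (hconn : G.Connected)
    (hd : ∀ x, 0 < G.degree x) {γ : ℝ} (hγ0 : 0 < γ) (hγ1 : γ ≤ 1)
    (hγ : lazySecondEigenvalue G ≤ 1 - γ) {D : ℕ} (hD : ∀ x, G.degree x ≤ D)
    (hlog : 8 / γ + 2 ≤ Real.log (Fintype.card V))
    (hlog2 : Real.log (Fintype.card V) ^ 2 ≤ Fintype.card V)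
    (hcard : 64 * D ^ 3 / γ ^ 2 ≤ Fintype.card V) {ε : unitInterval} (hε : 0 < ε) :
    coverTime G ε ≤ ENNReal.ofReal ((4 + 96 * D / γ) * ((Fintype.card V : ℝ) / (ε : ℝ) *
      Real.log (Real.log (Fintype.card V)))) := by
  have h0 : (0 : ℝ) < ε := hε
  have h1 : (ε : ℝ) ≤ 1 := ε.2.2
  have hne := hconn.nonempty
  have hD0 : (1 : ℝ) ≤ D := by
    obtain ⟨x⟩ := hne
    exact_mod_cast (hd x).trans_le (hD x)
  have hn : (0 : ℝ) < Fintype.card V := by exact_mod_cast Fintype.card_pos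
  set n : ℝ := (Fintype.card V : ℝ) with hndef
  set L := Real.log n with hL
  have h8 : 8 ≤ 8 / γ := by rw [le_div_iff₀ hγ0]; linarith
  have hL10 : 10 ≤ L := by linarith
  set T := ⌈4 / γ * L⌉₊ with hTdef
  have hTle : 4 / γ * L ≤ T := Nat.le_ceil _
  have hTlt : (T : ℝ) < 4 / γ * L + 1 := Nat.ceil_lt_add_one (by positivity)
  have hT : 0 < T := Nat.ceil_pos.2 (by positivity)
  have hT2 : 2 * (T : ℝ) ≤ L ^ 2 := by
    have : (8 / γ + 2) * L ≤ L * L := by gcongr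
    have e : 2 * (4 / γ * L + 1) = 8 / γ * L + 2 := by ring
    nlinarith
  have hT1 : (1 : ℝ) ≤ T := by exact_mod_cast hT
  have hTn : (T : ℝ) ≤ n := by linarith
  -- The `4` in `T` gives `(1 - γ) ^ T ≤ n ^ (-4)`, against a required order `n ^ (-3)`; the spare
  -- factor `n` absorbs `64 D ^ 3 / γ ^ 2`.
  have hmix : (1 - γ) ^ T * (D * n) ≤ (γ / (8 * (D * n))) ^ 2 := by
    have e1 : (1 - γ) ^ T ≤ (n ^ 4)⁻¹ := by
      calc (1 - γ) ^ T ≤ Real.exp (-γ) ^ T :=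
            pow_le_pow_left₀ (sub_nonneg.2 hγ1) (by linarith [Real.add_one_le_exp (-γ)]) T
        _ = Real.exp (-(γ * T)) := by rw [← Real.exp_nat_mul]; ring_nf
        _ ≤ Real.exp (-(4 * L)) := by
            rw [Real.exp_le_exp, neg_le_neg_iff]
            calc 4 * L = γ * (4 / γ * L) := by field_simp
              _ ≤ γ * T := by gcongr
        _ = (n ^ 4)⁻¹ := by
            have : Real.exp (4 * L) = n ^ 4 := by
              have := Real.exp_nat_mul L 4
              rw [Real.exp_log hn] at this
              exact_mod_cast this
            rw [Real.exp_neg, this]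
    calc (1 - γ) ^ T * (D * n) ≤ (n ^ 4)⁻¹ * (D * n) := by gcongr
      _ = (γ ^ 2 / (64 * D ^ 2 * n ^ 3)) * (64 * D ^ 3 / γ ^ 2) := by field_simp
      _ ≤ (γ ^ 2 / (64 * D ^ 2 * n ^ 3)) * n := by gcongr
      _ = _ := by field_simp; ring
  refine (coverTime_le_of_mixing hconn hd hγ0 hγ1 hγ hD hT (Nat.cast_le.1 hTn) hmix hε).trans
    (ENNReal.ofReal_le_ofReal ?_)
  rw [← hndef]
  have hll : 1 ≤ Real.log L := by
    rw [Real.le_log_iff_exp_le (by linarith)]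
    linarith [Real.exp_one_lt_d9]
  have hlogT : Real.log (2 * T) ≤ 2 * Real.log L := by
    have := Real.log_le_log (by positivity) hT2
    rwa [Real.log_pow] at this
  have hnε : n ≤ n / ε := by rw [le_div_iff₀ h0]; nlinarith
  set c := n / (ε : ℝ)
  set l := Real.log L
  have hc0 : 0 < c := by positivity
  have hcl : c ≤ c * l := le_mul_of_one_le_right hc0.le hll
  have hnl : n * l ≤ c * l := by gcongr
  have hK : 0 ≤ 32 * D / γ := by positivity
  calc 4 * (T : ℝ) + 32 * D / γ * n * Real.log (2 * T) + 32 * D / γ * c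
      ≤ 4 * n + 32 * D / γ * n * (2 * l) + 32 * D / γ * c := by gcongr
    _ = 4 * n + 32 * D / γ * (2 * (n * l)) + 32 * D / γ * c := by ring
    _ ≤ 4 * (c * l) + 32 * D / γ * (2 * (c * l)) + 32 * D / γ * (c * l) := by
        gcongr
        linarith
    _ = _ := by ring

end TBRW

end

theorem corollary3p3 (N : ℕ → ℕ) (hN : Tendsto N atTop atTop)
    (G : (k : ℕ) → SimpleGraph (Fin (N k))) [∀ k, DecidableRel (G k).Adj]
    (hconn : ∀ k, (G k).Connected)
    (hdeg : ∃ D : ℕ, ∀ k v, (G k).degree v ≤ D)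
    (hexp : TBRW.IsExpanderSequence G) :
    ∃ C : ℝ, ∀ᶠ k in atTop, ∀ ε : unitInterval, 0 < ε →
      TBRW.coverTime (G k) ε ≤
        ENNReal.ofReal (C * ((N k : ℝ) / (ε : ℝ) * Real.log (Real.log (N k : ℝ)))) := by
  obtain ⟨D, hD⟩ := hdeg
  obtain ⟨C, hC⟩ := hexp.1.bound
  -- `K⁻¹` will be the gap bound `γ`; the maximum with `1` ensures `γ ≤ 1`.
  set K := max C 1 with hK
  have hK0 : 0 < K := zero_lt_one.trans_le (le_max_right _ _)
  have hγ1 : K⁻¹ ≤ 1 := inv_le_one_of_one_le₀ (le_max_right _ _)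
  have hNr : Tendsto (fun k => (N k : ℝ)) atTop atTop := tendsto_natCast_atTop_atTop.comp hN
  have hlogsq : ∀ᶠ x : ℝ in atTop, Real.log x ^ 2 ≤ x := by
    filter_upwards [(Real.isLittleO_pow_log_id_atTop (n := 2)).bound zero_lt_one,
      eventually_ge_atTop 0] with x hx hx0
    simpa [abs_of_nonneg hx0] using hx
  refine ⟨4 + 96 * D / K⁻¹, ?_⟩
  filter_upwards [hC, hN.eventually_ge_atTop 2,
    (Real.tendsto_log_atTop.comp hNr).eventually_ge_atTop (8 / K⁻¹ + 2), hNr.eventually hlogsq,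
    hNr.eventually_ge_atTop (64 * D ^ 3 / K⁻¹ ^ 2)] with k hk h2 hlog hlog2 hcard ε hε
  have : Nontrivial (Fin (N k)) := Fin.nontrivial_iff_two_le.2 h2
  have hd : ∀ x, 0 < (G k).degree x := fun x =>
    (hconn k).preconnected.degree_pos_of_nontrivial x
  have hlt := TBRW.lazySecondEigenvalue_lt_one hd
  have hγ : TBRW.lazySecondEigenvalue (G k) ≤ 1 - K⁻¹ := by
    have h3 : (1 - TBRW.lazySecondEigenvalue (G k))⁻¹ ≤ K := by
      have := (le_abs_self _).trans hk
      simp only [norm_one, mul_one] at this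
      exact this.trans (le_max_left _ _)
    have := inv_le_of_inv_le₀ (sub_pos.2 hlt) h3
    linarith
  have := TBRW.coverTime_le_loglog (hconn k) hd (inv_pos.2 hK0) hγ1 hγ (hD k)
    (by simpa using hlog) (by simpa using hlog2) (by simpa using hcard) hε
  simpa using this
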